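/- For an integer $j\ge 0$, consider finite vertex-colored digraphs $G$ with at most $j$ vertices of each color. A feasible solution of jPC-TEx on $G$ is any set of vertex-disjoint simple directed cycles of $G$; a feasible solution of jPC-TMaxEx on $G$ is a set of vertex-disjoint simple directed cycles of $G$ such that no other such set contains more vertices. In both problems the number of colors that appear on the cycles is to be maximized. MAX-SIZE-EXCHANGE asks, for a digraph without colors, for a set of vertex-disjoint simple directed cycles with the maximum total number of vertices. For every fixed $j$ the following hold. 1. Every procedure that solves MAX-SIZE-EXCHANGE is, when run on $G$ with the colors ignored, a $j$-approximation for both jPC-TEx and jPC-TMaxEx: it returns a feasible solution, and the maximum number of colors of a feasible solution is at most $j$ times the number of colors of the returned one. In particular it is a $2$-approximation for $j=2$. 2. There is a procedure that solves MAX-SIZE-EXCHANGE and that, run on $G$ with the colors ignored, takes time polynomial in the size of $G$. 3. Consequently jPC-TEx and jPC-TMaxEx belong to APX, that is: each of them is an NP optimization problem (instances are recognizable in polynomial time, feasible solutions have polynomially bounded size and are recognizable in polynomial time, and the number of colors of a feasible solution is computable in polynomial time), and each has a polynomial-time approximation algorithm whose ratio is a constant. -/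

import Mathlib

namespace TropicalExchange

/-! ### Random access machines with a step count

Structured programs for a unit-cost random access machine.  The store has scalar variables and
arrays of natural numbers; a program mentions only finitely many of them.  The only arithmetic
is addition and truncated subtraction, so that after `t` steps all numbers have `O(t)` more bits
than the input: polynomial time on this machine is polynomial time on a Turing machine. -/

/-- Expressions: constants, variables, sum, truncated difference, and array access `k[e]`. -/
inductive Expr : Type
  | const (c : ℕ)
  | var (x : ℕ)
  | add (e₁ e₂ : Expr)
  | sub (e₁ e₂ : Expr)
  | get (k : ℕ) (e : Expr)

/-- Programs. A test `e` succeeds if its value is nonzero. -/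
inductive Prog : Type
  | skip
  | assign (x : ℕ) (e : Expr)
  | put (k : ℕ) (i e : Expr)
  | seq (p q : Prog)
  | ite (e : Expr) (p q : Prog)
  | loop (e : Expr) (p : Prog)

/-- A store: the value `var x` of each variable and the value `arr k i` of each array cell. -/
structure Store where
  var : ℕ → ℕ
  arr : ℕ → ℕ → ℕ

/-- The value of an expression. -/
def Expr.eval (s : Store) : Expr → ℕ
  | const c => c
  | var x => s.var x
  | add e₁ e₂ => e₁.eval s + e₂.eval s
  | sub e₁ e₂ => e₁.eval s - e₂.eval s
  | get k e => s.arr k (e.eval s)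

/-- The number of steps needed to evaluate an expression. -/
def Expr.cost : Expr → ℕ
  | const _ => 1
  | var _ => 1
  | add e₁ e₂ => e₁.cost + e₂.cost + 1
  | sub e₁ e₂ => e₁.cost + e₂.cost + 1
  | get _ e => e.cost + 1

/-- The store after `x := v`. -/
def Store.setVar (s : Store) (x v : ℕ) : Store :=
  { s with var := Function.update s.var x v }

/-- The store after `k[i] := v`. -/
def Store.setArr (s : Store) (k i v : ℕ) : Store :=
  { s with arr := Function.update s.arr k (Function.update (s.arr k) i v) }

/-- `Exec p s s' t`: started in the store `s`, the program `p` halts in the store `s'` after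
exactly `t` steps. -/
inductive Exec : Prog → Store → Store → ℕ → Prop
  | skip (s : Store) : Exec .skip s s 1
  | assign (s : Store) (x : ℕ) (e : Expr) :
      Exec (.assign x e) s (s.setVar x (e.eval s)) (e.cost + 1)
  | put (s : Store) (k : ℕ) (i e : Expr) :
      Exec (.put k i e) s (s.setArr k (i.eval s) (e.eval s)) (i.cost + e.cost + 1)
  | seq {p q : Prog} {s s' s'' : Store} {t t' : ℕ} (hp : Exec p s s' t) (hq : Exec q s' s'' t') :
      Exec (.seq p q) s s'' (t + t')
  | ite_true {e : Expr} {p q : Prog} {s s' : Store} {t : ℕ} (he : e.eval s ≠ 0)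
      (hp : Exec p s s' t) : Exec (.ite e p q) s s' (e.cost + 1 + t)
  | ite_false {e : Expr} {p q : Prog} {s s' : Store} {t : ℕ} (he : e.eval s = 0)
      (hq : Exec q s s' t) : Exec (.ite e p q) s s' (e.cost + 1 + t)
  | loop_stop {e : Expr} {p : Prog} {s : Store} (he : e.eval s = 0) :
      Exec (.loop e p) s s (e.cost + 1)
  | loop_step {e : Expr} {p : Prog} {s s' s'' : Store} {t t' : ℕ} (he : e.eval s ≠ 0)
      (hp : Exec p s s' t) (hl : Exec (.loop e p) s' s'' t') :
      Exec (.loop e p) s s'' (e.cost + 1 + t + t')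

/-- The initial store for a list of input words: the `k`-th word is in the array `k`, its
length is in the variable `k`, and everything else is `0`. -/
def Store.init (ws : List (List ℕ)) : Store where
  var k := (ws.getD k []).length
  arr k i := (ws.getD k []).getD i 0

/-- The output of a halted program: a word in the array `0` with its length in the variable
`0`. -/
def Store.output (s : Store) : List ℕ :=
  (List.range (s.var 0)).map (s.arr 0)

/-- The length of a word of numbers written in binary, with one separator per number. -/
def wordSize (w : List ℕ) : ℕ := (w.map fun a => a.size + 1).sum

/-- The total length of a list of input words. -/
def inputSize (ws : List (List ℕ)) : ℕ := (ws.map wordSize).sum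

/-- The map that takes `a`, given as the input words `inp a`, to the output word `out a` is
computable in polynomial time. -/
def PolyTimeComputable {α : Type} (inp : α → List (List ℕ)) (out : α → List ℕ) : Prop :=
  ∃ (p : Prog) (q : Polynomial ℕ), ∀ a : α, ∃ (s : Store) (t : ℕ),
    Exec p (Store.init (inp a)) s t ∧ t ≤ q.eval (inputSize (inp a)) ∧ s.output = out a

open Classical in
/-- The property `Q` of `a`, given as the input words `inp a`, is decidable in polynomial
time. -/
def PolyTimeDecidable {α : Type} (inp : α → List (List ℕ)) (Q : α → Prop) : Prop :=
  PolyTimeComputable inp fun a => if Q a then [1] else [0]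

/-! ### Optimization problems, NPO and APX -/

/-- A maximization problem: instances, candidate solutions of each instance, which of them are
feasible, and their measure, with encodings as words. -/
structure MaxProblem where
  Inst : Type
  Sol : Inst → Type
  encInst : Inst → List ℕ
  encSol : (x : Inst) → Sol x → List ℕ
  feasible : (x : Inst) → Sol x → Prop
  measure : (x : Inst) → Sol x → ℕ
  encInst_injective : Function.Injective encInst
  encSol_injective : ∀ x, Function.Injective (encSol x)

namespace MaxProblem

/-- The class NPO: instances are recognizable in polynomial time, feasible solutions are
polynomially short and recognizable in polynomial time, and the measure is computable in
polynomial time. -/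
structure IsNPO (P : MaxProblem) : Prop where
  instances : PolyTimeDecidable (fun w : List ℕ => [w]) (fun w => ∃ x, P.encInst x = w)
  short : ∃ q : Polynomial ℕ, ∀ x y, P.feasible x y →
    wordSize (P.encSol x y) ≤ q.eval (wordSize (P.encInst x))
  solutions : PolyTimeDecidable (fun a : P.Inst × List ℕ => [P.encInst a.1, a.2])
    (fun a => ∃ y, P.feasible a.1 y ∧ P.encSol a.1 y = a.2)
  measure : PolyTimeComputable
    (fun a : (x : P.Inst) × {y : P.Sol x // P.feasible x y} =>
      [P.encInst a.1, P.encSol a.1 a.2.1])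
    (fun a => [P.measure a.1 a.2.1])

/-- `A` is an `r`-approximation: it returns a feasible solution, and the measure of no feasible
solution exceeds `r` times the measure of the returned one. -/
def IsApprox (P : MaxProblem) (r : ℝ) (A : (x : P.Inst) → P.Sol x) : Prop :=
  ∀ x, P.feasible x (A x) ∧
    ∀ y, P.feasible x y → (P.measure x y : ℝ) ≤ r * (P.measure x (A x) : ℝ)

/-- `A` runs in polynomial time. -/
def PolyTime (P : MaxProblem) (A : (x : P.Inst) → P.Sol x) : Prop :=
  PolyTimeComputable (fun x : P.Inst => [P.encInst x]) (fun x => P.encSol x (A x))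

/-- The class APX: NPO problems with a polynomial-time approximation of constant ratio. -/
def InAPX (P : MaxProblem) : Prop :=
  P.IsNPO ∧ ∃ r : ℝ, 1 ≤ r ∧ ∃ A : (x : P.Inst) → P.Sol x, P.PolyTime A ∧ P.IsApprox r A

end MaxProblem

/-! ### Exchanges -/

section Exchange

variable {V : Type*} [DecidableEq V]

/-- `c` lists, in order, the vertices of a simple directed cycle of `G`. -/
def IsDicycle (G : Digraph V) (c : List V) : Prop :=
  c ≠ [] ∧ c.Nodup ∧ (c : Cycle V).Chain G.Adj

/-- `S` is a set of vertex-disjoint cycles of `G`. -/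
def IsExchange (G : Digraph V) (S : List (List V)) : Prop :=
  (∀ c ∈ S, IsDicycle G c) ∧ S.Pairwise List.Disjoint

/-- The set of vertices in the cycles of `S`. -/
def verts (S : List (List V)) : Finset V := S.flatten.toFinset

/-- `S` is a set of vertex-disjoint cycles of `G` with the maximum number of vertices. -/
def IsMaxSizeExchange (G : Digraph V) (S : List (List V)) : Prop :=
  IsExchange G S ∧ ∀ T, IsExchange G T → (verts T).card ≤ (verts S).card

/-- The number of colors that appear in the cycles of `S`. -/
def numColors {C : Type*} [DecidableEq C] (color : V → C) (S : List (List V)) : ℕ :=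
  ((verts S).image color).card

end Exchange

/-- A vertex-colored digraph on the vertices `0, …, n - 1`. -/
structure ColoredDigraph where
  n : ℕ
  graph : Digraph (Fin n)
  color : Fin n → ℕ

open Classical in
/-- The word `n`, the colors of the vertices, the adjacency matrix row by row. -/
noncomputable def ColoredDigraph.enc (x : ColoredDigraph) : List ℕ :=
  x.n :: (List.ofFn x.color ++
    List.ofFn fun i : Fin (x.n * x.n) => if x.graph.Adj i.divNat i.modNat then 1 else 0)

/-- The word that lists, for each cycle, its length and then its vertices. -/
def encCycles {n : ℕ} (S : List (List (Fin n))) : List ℕ :=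
  S.flatMap fun c => c.length :: c.map Fin.val

theorem ColoredDigraph.enc_injective : Function.Injective ColoredDigraph.enc := by
  rintro ⟨n, G, c⟩ ⟨m, H, d⟩ h
  simp only [ColoredDigraph.enc, List.cons.injEq] at h
  obtain ⟨rfl, h⟩ := h
  obtain ⟨h1, h2⟩ := List.append_inj h (by simp)
  have hc := List.ofFn_injective h1
  have hG := List.ofFn_injective h2
  have : G = H := by
    ext u v
    have := congrFun hG (finProdFinEquiv (u, v))
    have e : finProdFinEquiv.symm (finProdFinEquiv (u, v)) = (u, v) := by simp
    have e1 : (finProdFinEquiv (u, v)).divNat = u := congrArg Prod.fst e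
    have e2 : (finProdFinEquiv (u, v)).modNat = v := congrArg Prod.snd e
    rw [e1, e2] at this
    by_cases hg : G.Adj u v <;> by_cases hh : H.Adj u v <;> simp_all
  subst this
  subst hc
  rfl

theorem encCycles_injective (n : ℕ) : Function.Injective (encCycles (n := n)) := by
  intro S
  induction S with
  | nil => intro T h; cases T <;> simp_all [encCycles]
  | cons c S ih =>
    intro T h
    cases T with
    | nil => simp [encCycles] at h
    | cons d T =>
      simp only [encCycles, List.flatMap_cons, List.cons_append, List.cons.injEq] at h
      obtain ⟨h0, h⟩ := h
      obtain ⟨h1, h2⟩ := List.append_inj h (by simpa using h0)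
      rw [List.map_injective_iff.2 Fin.val_injective h1, ih h2]

/-- Vertex-colored digraphs with at most `j` vertices of each color. -/
abbrev PerColorDigraph (j : ℕ) : Type :=
  {x : ColoredDigraph // ∀ c : ℕ, (Finset.univ.filter fun v => x.color v = c).card ≤ j}

theorem PerColorDigraph.enc_injective (j : ℕ) :
    Function.Injective fun x : PerColorDigraph j => x.1.enc :=
  ColoredDigraph.enc_injective.comp Subtype.val_injective

/-- jPC-TEx: find a set of vertex-disjoint cycles with the maximum number of colors. -/
@[reducible] noncomputable def jPCTEx (j : ℕ) : MaxProblem where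
  Inst := PerColorDigraph j
  Sol x := List (List (Fin x.1.n))
  encInst x := x.1.enc
  encSol _ S := encCycles S
  feasible x S := IsExchange x.1.graph S
  measure x S := numColors x.1.color S
  encInst_injective := PerColorDigraph.enc_injective j
  encSol_injective x := encCycles_injective x.1.n

/-- jPC-TMaxEx: find a set of vertex-disjoint cycles with the maximum number of colors among
those with the maximum number of vertices. -/
@[reducible] noncomputable def jPCTMaxEx (j : ℕ) : MaxProblem where
  Inst := PerColorDigraph j
  Sol x := List (List (Fin x.1.n))
  encInst x := x.1.enc
  encSol _ S := encCycles S
  feasible x S := IsMaxSizeExchange x.1.graph S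
  measure x S := numColors x.1.color S
  encInst_injective := PerColorDigraph.enc_injective j
  encSol_injective x := encCycles_injective x.1.n

/-- A procedure that takes an uncolored digraph to a list of lists of vertices. -/
abbrev DigraphProcedure : Type := (n : ℕ) → Digraph (Fin n) → List (List (Fin n))

/-- `A` solves MAX-SIZE-EXCHANGE. -/
def SolvesMaxSizeExchange (A : DigraphProcedure) : Prop :=
  ∀ (n : ℕ) (G : Digraph (Fin n)), IsMaxSizeExchange G (A n G)

/-- `A` run on the digraph of a colored instance, ignoring the colors. -/
def ignoreColors (A : DigraphProcedure) {j : ℕ} (x : PerColorDigraph j) :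
    List (List (Fin x.1.n)) :=
  A x.1.n x.1.graph

end TropicalExchange

namespace TropicalExchange

/-! The ratio is a counting argument. A feasible solution with vertex set `X` shows at most `|X|`
colors, a maximum exchange `S` covers at least `|X|` vertices, and each color sits on at most `j` of
them, so `S` shows at least `|X| / j` colors (`numColors_le_mul`). A maximum exchange is feasible
for both problems, so one argument serves both.

For the algorithm, an exchange is read as a permutation that moves each vertex along an arc or fixes
it (`Follows`). Multiplying cyclic permutations turns cycles into such a permutation
(`IsExchange.exists_perm`), and its orbits give the cycles back (`isMaxSizeExchange_cyclesOf`).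
MAX-SIZE-EXCHANGE thus becomes an assignment problem, solved here by an auction with unit price
increments: every bidder ends up within one of the best object at the final prices, so the total
value is within `n` of the optimum (`exists_perm_of_auction`). The weights are scaled so that a
non-arc or a missing arc costs more than `n`; hence the result is exactly optimal
(`exists_perm_of_auction_weight`). Prices stay bounded, so polynomially many bids suffice.

Polynomial time is obtained through a small language of terms and commands whose loops all have the
same fixed bound. They denote total functions and compile to machine programs with polynomial step
counts (`Term.runs_compile`, `Cmd.runs_compile`, `polyTimeComputable_of_cmd`), so each algorithm
needs only a correctness proof by loop invariants. The NPO conditions use a one-pass scanner that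
recognizes the words of exchanges (`Loaded.run_scanCmd`); maximality is tested by comparing the
number of scanned vertices with the optimum found by the auction. -/

/-! ### A language of bounded loops

Commands whose loops all run over the numbers below the value of variable `2`, which no command
writes.  Such a command denotes a total function on stores, and it compiles to a program with a
polynomial number of steps. -/

/-- `Runs p s s' T`: started in `s`, the program `p` halts in `s'` after at most `T` steps. -/
def Runs (p : Prog) (s s' : Store) (T : ℕ) : Prop := ∃ t ≤ T, Exec p s s' t

namespace Runs

theorem mono {p : Prog} {s s' : Store} {T T' : ℕ} (h : Runs p s s' T) (hT : T ≤ T') :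
    Runs p s s' T' :=
  let ⟨t, ht, hp⟩ := h
  ⟨t, ht.trans hT, hp⟩

theorem skip (s : Store) : Runs .skip s s 1 := ⟨1, le_rfl, .skip s⟩

theorem assign (s : Store) (x : ℕ) (e : Expr) :
    Runs (.assign x e) s (s.setVar x (e.eval s)) (e.cost + 1) :=
  ⟨_, le_rfl, .assign s x e⟩

theorem put (s : Store) (k : ℕ) (i e : Expr) :
    Runs (.put k i e) s (s.setArr k (i.eval s) (e.eval s)) (i.cost + e.cost + 1) :=
  ⟨_, le_rfl, .put s k i e⟩

theorem seq {p q : Prog} {s s' s'' : Store} {T T' : ℕ} (hp : Runs p s s' T)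
    (hq : Runs q s' s'' T') : Runs (.seq p q) s s'' (T + T') :=
  let ⟨_, ht, hp⟩ := hp
  let ⟨_, ht', hq⟩ := hq
  ⟨_, Nat.add_le_add ht ht', .seq hp hq⟩

theorem ite_true {e : Expr} {p q : Prog} {s s' : Store} {T : ℕ} (he : e.eval s ≠ 0)
    (hp : Runs p s s' T) : Runs (.ite e p q) s s' (e.cost + 1 + T) :=
  let ⟨_, ht, hp⟩ := hp
  ⟨_, Nat.add_le_add_left ht _, .ite_true he hp⟩

theorem ite_false {e : Expr} {p q : Prog} {s s' : Store} {T : ℕ} (he : e.eval s = 0)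
    (hq : Runs q s s' T) : Runs (.ite e p q) s s' (e.cost + 1 + T) :=
  let ⟨_, ht, hq⟩ := hq
  ⟨_, Nat.add_le_add_left ht _, .ite_false he hq⟩

/-- A loop that counts the variable `y` up to the value `N` of variable `2`. -/
theorem count {p : Prog} {y N T : ℕ} (I : ℕ → Store → Prop)
    (hI : ∀ i < N, ∀ r, I i r → ∃ r', Runs p r r' T ∧ I (i + 1) r')
    (hy : ∀ i r, I i r → r.var y = i ∧ r.var 2 = N) (m : ℕ) :
    ∀ i r, i + m = N → I i r →
      ∃ r', Runs (.loop (.sub (.var 2) (.var y)) p) r r' (m * (T + 4) + 4) ∧ I N r' := by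
  -- `m` counts the rounds still to come, and 4 is the cost of one loop test.
  induction m with
  | zero =>
    intro i r hi h
    obtain ⟨h1, h2⟩ := hy i r h
    have hi : i = N := hi
    exact ⟨r, ⟨4, by simp, Exec.loop_stop (by simp [Expr.eval, h1, h2, hi])⟩, hi ▸ h⟩
  | succ m ih =>
    intro i r hi h
    obtain ⟨h1, h2⟩ := hy i r h
    obtain ⟨r', ⟨t, ht, hp⟩, h'⟩ := hI i (by omega) r h
    obtain ⟨r'', ⟨t', ht', hl⟩, h''⟩ := ih (i + 1) r' (by omega) h'
    refine ⟨r'', ⟨_, ?_, Exec.loop_step ?_ hp hl⟩, h''⟩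
    · simp only [Expr.cost]
      linarith [Nat.succ_mul m (T + 4)]
    · simp only [Expr.eval, h1, h2]
      omega

end Runs

@[simp] theorem Store.setVar_var (s : Store) (x v y : ℕ) :
    (s.setVar x v).var y = if y = x then v else s.var y := by
  simp [Store.setVar, Function.update_apply]

@[simp] theorem Store.setVar_arr (s : Store) (x v : ℕ) : (s.setVar x v).arr = s.arr := rfl

@[simp] theorem Store.setArr_var (s : Store) (k i v : ℕ) : (s.setArr k i v).var = s.var := rfl

@[simp] theorem Store.setArr_arr (s : Store) (k i v l : ℕ) :
    (s.setArr k i v).arr l = if l = k then Function.update (s.arr k) i v else s.arr l := by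
  by_cases h : l = k
  · subst h; simp [Store.setArr]
  · simp [Store.setArr, h]

/-- Terms: expressions with conditionals and with sums over the numbers below variable `2`. -/
inductive Term : Type
  | const (c : ℕ)
  | var (x : ℕ)
  | add (a b : Term)
  | sub (a b : Term)
  | get (k : ℕ) (a : Term)
  | ite (c a b : Term)
  | sum (x : ℕ) (a : Term)

/-- Commands; `each x p` runs `p` for all values of `x` below the value of variable `2`. -/
inductive Cmd : Type
  | skip
  | assign (x : ℕ) (a : Term)
  | put (k : ℕ) (i a : Term)
  | seq (p q : Cmd)
  | ite (c : Term) (p q : Cmd)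
  | each (x : ℕ) (p : Cmd)

/-- `f (n - 1) (… (f 0 a))`. -/
def forRange {α : Type*} (f : ℕ → α → α) : ℕ → α → α
  | 0, a => a
  | n + 1, a => f n (forRange f n a)

/-! ### Semantics and compilation of terms -/

namespace Term

/-- The value of a term. -/
def eval : Term → Store → ℕ
  | const c, _ => c
  | var x, s => s.var x
  | add a b, s => a.eval s + b.eval s
  | sub a b, s => a.eval s - b.eval s
  | get k a, s => s.arr k (a.eval s)
  | ite c a b, s => if c.eval s = 0 then b.eval s else a.eval s
  | sum x a, s => ∑ i ∈ Finset.range (s.var 2), a.eval (s.setVar x i)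

/-- All variables of the term are below `d`, and it does not bind variable `2`. -/
def wf (d : ℕ) : Term → Bool
  | const _ => true
  | var x => decide (x < d)
  | add a b => a.wf d && b.wf d
  | sub a b => a.wf d && b.wf d
  | get _ a => a.wf d
  | ite c a b => c.wf d && (a.wf d && b.wf d)
  | sum x a => decide (x < d) && (decide (x ≠ 2) && a.wf d)

/-- A program that puts the value of the term in variable `d`. -/
def compile (d : ℕ) : Term → Prog
  | const c => .assign d (.const c)
  | var x => .assign d (.var x)
  | add a b =>
    .seq (a.compile d) (.seq (b.compile (d + 1)) (.assign d (.add (.var d) (.var (d + 1)))))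
  | sub a b =>
    .seq (a.compile d) (.seq (b.compile (d + 1)) (.assign d (.sub (.var d) (.var (d + 1)))))
  | get k a => .seq (a.compile d) (.assign d (.get k (.var d)))
  | ite c a b => .seq (c.compile d) (.ite (.var d) (a.compile d) (b.compile d))
  | sum x a =>
    .seq (.assign d (.const 0)) <| .seq (.assign (d + 1) (.var x)) <|
    .seq (.assign x (.const 0)) <|
    .seq (.loop (.sub (.var 2) (.var x)) <|
      .seq (a.compile (d + 2)) <| .seq (.assign d (.add (.var d) (.var (d + 2)))) <|
        .assign x (.add (.var x) (.const 1))) <|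
    .assign x (.var (d + 1))

open Polynomial in
/-- A bound on the running time of the compiled term. -/
noncomputable def cost : Term → Polynomial ℕ
  | const _ => 2
  | var _ => 2
  | add a b => a.cost + (b.cost + 4)
  | sub a b => a.cost + (b.cost + 4)
  | get _ a => a.cost + 3
  | ite c a b => c.cost + (2 + (a.cost + b.cost))
  | sum _ a => X * (a.cost + 12) + 12

/-- Scratch variables lie at or above `d`, so compiled code can use them without disturbing the
value of a source term. The bound `2 < d` is needed because sums read variable `2`. -/
theorem eval_congr {d : ℕ} (hd : 2 < d) (a : Term) : ∀ {r s : Store}, a.wf d →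
    r.arr = s.arr → (∀ x < d, r.var x = s.var x) → a.eval r = a.eval s := by
  induction a with
  | const c => intros; rfl
  | var x => intro r s h _ hv; exact hv x (by simpa [wf] using h)
  | add a b iha ihb | sub a b iha ihb =>
    intro r s h ha hv
    simp only [wf, Bool.and_eq_true] at h
    simp only [eval, iha h.1 ha hv, ihb h.2 ha hv]
  | get k a ih => intro r s h ha hv; simp only [eval, ih h ha hv, ha]
  | ite c a b ihc iha ihb =>
    intro r s h ha hv
    simp only [wf, Bool.and_eq_true] at h
    simp only [eval, ihc h.1 ha hv, iha h.2.1 ha hv, ihb h.2.2 ha hv]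
  | sum x a ih =>
    intro r s h ha hv
    simp only [wf, Bool.and_eq_true] at h
    simp only [eval, hv 2 hd]
    refine Finset.sum_congr rfl fun i _ => ih h.2.2 ha fun y hy => ?_
    simp [hv y hy]

/-- The variables from `D` on serve as a stack. Since nothing below `D` changes, a first operand
left in `D` survives the evaluation of a second one at `D + 1`; this is why `D` varies in the
induction while `d` is fixed. -/
theorem runs_compile {d : ℕ} (hd : 2 < d) (a : Term) (hwf : a.wf d) : ∀ (D : ℕ) (r : Store),
    d ≤ D → ∃ r', Runs (a.compile D) r r' (a.cost.eval (r.var 2)) ∧ r'.arr = r.arr ∧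
      (∀ x < D, r'.var x = r.var x) ∧ r'.var D = a.eval r := by
  induction a with
  | const c =>
    intro D r _
    exact ⟨_, (Runs.assign _ _ _).mono (by simp [Expr.cost, cost]), rfl,
      fun x hx => by simp [hx.ne], by simp [Expr.eval, eval]⟩
  | var c =>
    intro D r _
    exact ⟨_, (Runs.assign _ _ _).mono (by simp [Expr.cost, cost]), rfl,
      fun x hx => by simp [hx.ne], by simp [Expr.eval, eval]⟩
  | add a b iha ihb | sub a b iha ihb =>
    intro D r hD
    simp only [wf, Bool.and_eq_true] at hwf
    obtain ⟨r1, h1, ha1, hv1, e1⟩ := iha hwf.1 D r hD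
    obtain ⟨r2, h2, ha2, hv2, e2⟩ := ihb hwf.2 (D + 1) r1 (by omega)
    refine ⟨_, (h1.seq (h2.seq (Runs.assign _ _ _))).mono ?_, ha2.trans ha1, fun x hx => ?_, ?_⟩
    · rw [hv1 2 (by omega)]
      simp [Expr.cost, cost]
    · simp [hx.ne, hv2 x (by omega), hv1 x hx]
    · simp only [Expr.eval, Store.setVar_var, if_true, eval]
      rw [hv2 D (by omega), e1, e2,
        eval_congr hd b hwf.2 ha1 fun x hx => hv1 x (by omega)]
  | get k a ih =>
    intro D r hD
    obtain ⟨r1, h1, ha1, hv1, e1⟩ := ih hwf D r hD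
    refine ⟨_, (h1.seq (Runs.assign _ _ _)).mono (by simp [Expr.cost, cost]), ha1,
      fun x hx => ?_, ?_⟩
    · simp [hx.ne, hv1 x hx]
    · simp [Expr.eval, eval, e1, ha1]
  | ite c a b ihc iha ihb =>
    intro D r hD
    simp only [wf, Bool.and_eq_true] at hwf
    obtain ⟨r1, h1, ha1, hv1, e1⟩ := ihc hwf.1 D r hD
    have hv1' : ∀ x < d, r1.var x = r.var x := fun x hx => hv1 x (by omega)
    by_cases hc : c.eval r = 0
    · obtain ⟨r2, h2, ha2, hv2, e2⟩ := ihb hwf.2.2 D r1 hD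
      refine ⟨r2, (h1.seq (Runs.ite_false (by simp [Expr.eval, e1, hc]) h2)).mono ?_,
        ha2.trans ha1, fun x hx => (hv2 x hx).trans (hv1 x hx), ?_⟩
      · rw [hv1 2 (by omega)]
        simp [Expr.cost, cost]
      · simp [e2, eval, hc, eval_congr hd b hwf.2.2 ha1 hv1']
    · obtain ⟨r2, h2, ha2, hv2, e2⟩ := iha hwf.2.1 D r1 hD
      refine ⟨r2, (h1.seq (Runs.ite_true (by simp [Expr.eval, e1, hc]) h2)).mono ?_,
        ha2.trans ha1, fun x hx => (hv2 x hx).trans (hv1 x hx), ?_⟩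
      · rw [hv1 2 (by omega)]
        simp [Expr.cost, cost]
      · simp [e2, eval, hc, eval_congr hd a hwf.2.1 ha1 hv1']
  | sum x a ih =>
    intro D r hD
    simp only [wf, Bool.and_eq_true, decide_eq_true_eq] at hwf
    obtain ⟨hx, hx2, hwf⟩ := hwf
    set N := r.var 2 with hN
    -- Variable `D` holds the partial sum and `D + 1` the old value of `x`. The bound variable is
    -- exempt from the frame condition during the loop and is restored afterwards.
    let I : ℕ → Store → Prop := fun i q => q.arr = r.arr ∧
      (∀ y < D, y ≠ x → q.var y = r.var y) ∧ q.var x = i ∧ q.var (D + 1) = r.var x ∧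
      q.var D = ∑ k ∈ Finset.range i, a.eval (r.setVar x k)
    obtain ⟨q, hq, hqa, hqv, hqx, hq1, hqD⟩ := Runs.count (y := x) (N := N) (T := a.cost.eval N + 8)
      (p := .seq (a.compile (D + 2)) <| .seq (.assign D (.add (.var D) (.var (D + 2)))) <|
        .assign x (.add (.var x) (.const 1))) I
      (by
        rintro i - q ⟨hqa, hqv, hqx, hq1, hqD⟩
        obtain ⟨q1, h1, ha1, hv1, e1⟩ := ih hwf (D + 2) q (by omega)
        have e2 : a.eval q = a.eval (r.setVar x i) := by
          refine eval_congr hd a hwf hqa fun y hy => ?_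
          by_cases hyx : y = x
          · simp [hyx, hqx]
          · simp [hyx, hqv y (by omega) hyx]
        refine ⟨_, (h1.seq ((Runs.assign _ _ _).seq (Runs.assign _ _ _))).mono ?_, ?_, ?_, ?_, ?_,
          ?_⟩
        · rw [hqv 2 (by omega) hx2.symm, ← hN]
          simp [Expr.cost]
        · exact ha1.trans hqa
        · intro y hy hyx
          simp [hyx, hy.ne, hv1 y (by omega), hqv y hy hyx]
        · have : x ≠ D := by omega
          simp [Expr.eval, this, hv1 x (by omega), hqx]
        · have : D + 1 ≠ x := by omega
          simp [Expr.eval, this, hv1 (D + 1) (by omega), hq1]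
        · have : D ≠ x := by omega
          simp [Expr.eval, this, hv1 D (by omega), hqD, e1, e2, Finset.sum_range_succ])
      (by
        rintro i q ⟨hqa, hqv, hqx, hq1, hqD⟩
        exact ⟨hqx, hqv 2 (by omega) hx2.symm⟩) N 0
      (((r.setVar D 0).setVar (D + 1) (r.var x)).setVar x 0) (by omega) (by
        have h1 : D + 1 ≠ x := by omega
        have h2 : D ≠ x := by omega
        refine ⟨rfl, fun y hy hyx => ?_, by simp, by simp [h1], by simp [h2]⟩
        simp [hyx, hy.ne, (show y ≠ D + 1 by omega)])
    have hloop := (Runs.assign r D (.const 0)).seq <|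
      (Runs.assign _ (D + 1) (.var x)).seq <| (Runs.assign _ x (.const 0)).seq <|
      (show Runs _ _ _ _ by
        simpa [Expr.eval, show x ≠ D by omega] using hq).seq (Runs.assign _ x (.var (D + 1)))
    refine ⟨_, hloop.mono ?_, hqa, fun y hy => ?_, ?_⟩
    · simp only [Expr.cost, cost, Polynomial.eval_add, Polynomial.eval_mul, Polynomial.eval_X,
        Polynomial.eval_ofNat]
      rw [add_assoc _ 8 4]
      norm_num
      omega
    · by_cases hyx : y = x
      · simp [hyx, Expr.eval, hq1]
      · simp [hyx, hqv y hy hyx]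
    · have : D ≠ x := by omega
      simp [this, hqD, eval, hN]

end Term

/-! ### Semantics, frame rules and compilation of commands -/

namespace Cmd

/-- The store after the command. -/
def run : Cmd → Store → Store
  | skip, s => s
  | assign x a, s => s.setVar x (a.eval s)
  | put k i a, s => s.setArr k (i.eval s) (a.eval s)
  | seq p q, s => q.run (p.run s)
  | ite c p q, s => if c.eval s = 0 then q.run s else p.run s
  | each x p, s => forRange (fun i s' => p.run (s'.setVar x i)) (s.var 2) s

/-- All variables of the command are below `d`, and it does not write variable `2`. -/
def wf (d : ℕ) : Cmd → Bool
  | skip => true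
  | assign x a => decide (x < d) && (decide (x ≠ 2) && a.wf d)
  | put _ i a => i.wf d && a.wf d
  | seq p q => p.wf d && q.wf d
  | ite c p q => c.wf d && (p.wf d && q.wf d)
  | each x p => decide (x < d) && (decide (x ≠ 2) && p.wf d)

/-- Whether the command writes variable `y`. -/
def writesVar (y : ℕ) : Cmd → Bool
  | skip => false
  | assign x _ => decide (x = y)
  | put _ _ _ => false
  | seq p q => p.writesVar y || q.writesVar y
  | ite _ p q => p.writesVar y || q.writesVar y
  | each x p => decide (x = y) || p.writesVar y

/-- Whether the command writes array `l`. -/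
def writesArr (l : ℕ) : Cmd → Bool
  | skip => false
  | assign _ _ => false
  | put k _ _ => decide (k = l)
  | seq p q => p.writesArr l || q.writesArr l
  | ite _ p q => p.writesArr l || q.writesArr l
  | each _ p => p.writesArr l

/-- Frame rules, this one and the next. The predicates on written variables and arrays compute, so
for concrete commands the side conditions hold by `rfl`. -/
theorem run_var {y : ℕ} (p : Cmd) : ∀ s : Store, p.writesVar y = false →
    (p.run s).var y = s.var y := by
  induction p with
  | skip => intros; rfl
  | assign x a =>
    intro s h
    simp only [writesVar, decide_eq_false_iff_not] at h
    simp [run, Ne.symm h]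
  | put k i a => intros; rfl
  | seq p q ihp ihq =>
    intro s h
    simp only [writesVar, Bool.or_eq_false_iff] at h
    simp only [run, ihq _ h.2, ihp _ h.1]
  | ite c p q ihp ihq =>
    intro s h
    simp only [writesVar, Bool.or_eq_false_iff] at h
    simp only [run]
    split_ifs
    exacts [ihq _ h.2, ihp _ h.1]
  | each x p ih =>
    intro s h
    simp only [writesVar, Bool.or_eq_false_iff, decide_eq_false_iff_not] at h
    have key (n : ℕ) : (forRange (fun i s' => p.run (s'.setVar x i)) n s).var y = s.var y := by
      induction n with
      | zero => rfl
      | succ n ihn => simp [forRange, ih _ h.2, Ne.symm h.1, ihn]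
    exact key _

theorem run_arr {l : ℕ} (p : Cmd) : ∀ s : Store, p.writesArr l = false →
    (p.run s).arr l = s.arr l := by
  induction p with
  | skip => intros; rfl
  | assign x a => intros; rfl
  | put k i a =>
    intro s h
    simp only [writesArr, decide_eq_false_iff_not] at h
    simp [run, Ne.symm h]
  | seq p q ihp ihq =>
    intro s h
    simp only [writesArr, Bool.or_eq_false_iff] at h
    simp only [run, ihq _ h.2, ihp _ h.1]
  | ite c p q ihp ihq =>
    intro s h
    simp only [writesArr, Bool.or_eq_false_iff] at h
    simp only [run]
    split_ifs
    exacts [ihq _ h.2, ihp _ h.1]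
  | each x p ih =>
    intro s h
    have key (n : ℕ) : (forRange (fun i s' => p.run (s'.setVar x i)) n s).arr l = s.arr l := by
      induction n with
      | zero => rfl
      | succ n ihn => simp [forRange, ih _ h, ihn]
    exact key _

/-- A program for the command, with auxiliary variables from `d` on. -/
def compile (d : ℕ) : Cmd → Prog
  | skip => .skip
  | assign x a => .seq (a.compile d) (.assign x (.var d))
  | put k i a =>
    .seq (i.compile d) (.seq (a.compile (d + 1)) (.put k (.var d) (.var (d + 1))))
  | seq p q => .seq (p.compile d) (q.compile d)
  | ite c p q => .seq (c.compile d) (.ite (.var d) (p.compile d) (q.compile d))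
  | each x p =>
    .seq (.assign d (.const 0)) <| .loop (.sub (.var 2) (.var d)) <|
      .seq (.assign x (.var d)) <| .seq (p.compile (d + 1)) <|
        .assign d (.add (.var d) (.const 1))

open Polynomial in
/-- A bound on the running time of the compiled command. -/
noncomputable def cost : Cmd → Polynomial ℕ
  | skip => 1
  | assign _ a => a.cost + 2
  | put _ i a => i.cost + (a.cost + 3)
  | seq p q => p.cost + q.cost
  | ite c p q => c.cost + (2 + (p.cost + q.cost))
  | each _ p => X * (p.cost + 10) + 6

theorem writesVar_two {d : ℕ} (p : Cmd) (h : p.wf d) : p.writesVar 2 = false := by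
  induction p <;> simp_all [wf, writesVar]

theorem run_var_two {d : ℕ} (p : Cmd) (s : Store) (h : p.wf d) : (p.run s).var 2 = s.var 2 :=
  run_var p s (writesVar_two p h)

/-- A simulation: `s` is the store of the command and `r` that of the program, and they need to
agree only on arrays and below `d`. The last clause protects the counters of enclosing loops, which
live between `d` and `D`; the loop counter is kept apart from the source variable `x`, so the body
may overwrite `x`. -/
theorem runs_compile {d : ℕ} (hd : 2 < d) (p : Cmd) (hwf : p.wf d) : ∀ (D : ℕ) (r s : Store),
    d ≤ D → r.arr = s.arr → (∀ x < d, r.var x = s.var x) →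
    ∃ r', Runs (p.compile D) r r' (p.cost.eval (s.var 2)) ∧ r'.arr = (p.run s).arr ∧
      (∀ x < d, r'.var x = (p.run s).var x) ∧ ∀ x, d ≤ x → x < D → r'.var x = r.var x := by
  induction p with
  | skip =>
    intro D r s _ ha hv
    exact ⟨r, (Runs.skip r).mono (by simp [cost]), ha, hv, fun _ _ _ => rfl⟩
  | assign x a =>
    intro D r s hD ha hv
    simp only [wf, Bool.and_eq_true, decide_eq_true_eq] at hwf
    obtain ⟨r1, h1, ha1, hv1, e1⟩ := Term.runs_compile hd a hwf.2.2 D r hD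
    refine ⟨_, (h1.seq (Runs.assign _ _ _)).mono ?_, ha1.trans ha, fun y hy => ?_,
      fun y hy hy' => ?_⟩
    · rw [hv 2 hd]; simp [cost, Expr.cost]
    · simp [run, Expr.eval, e1, Term.eval_congr hd a hwf.2.2 ha hv, hv1 y (by omega), hv y hy]
    · simp [hv1 y hy', show y ≠ x by omega]
  | put k i a =>
    intro D r s hD ha hv
    simp only [wf, Bool.and_eq_true] at hwf
    obtain ⟨r1, h1, ha1, hv1, e1⟩ := Term.runs_compile hd i hwf.1 D r hD
    obtain ⟨r2, h2, ha2, hv2, e2⟩ := Term.runs_compile hd a hwf.2 (D + 1) r1 (by omega)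
    refine ⟨_, (h1.seq (h2.seq (Runs.put _ _ _ _))).mono ?_, ?_, fun y hy => ?_,
      fun y hy hy' => ?_⟩
    · rw [hv1 2 (by omega), hv 2 hd]; simp [cost, Expr.cost]
    · have e3 : a.eval r1 = a.eval s := Term.eval_congr hd a hwf.2 (ha1.trans ha) fun y hy =>
        (hv1 y (by omega)).trans (hv y hy)
      simp only [Expr.eval, run, hv2 D (by omega), e1, e2, e3,
        Term.eval_congr hd i hwf.1 ha hv]
      simp [Store.setArr, ha2, ha1, ha]
    · simp [run, hv2 y (by omega), hv1 y (by omega), hv y hy]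
    · simp [hv2 y (by omega), hv1 y hy']
  | seq p q ihp ihq =>
    intro D r s hD ha hv
    simp only [wf, Bool.and_eq_true] at hwf
    obtain ⟨r1, h1, ha1, hv1, hf1⟩ := ihp hwf.1 D r s hD ha hv
    obtain ⟨r2, h2, ha2, hv2, hf2⟩ := ihq hwf.2 D r1 _ hD ha1 hv1
    refine ⟨r2, (h1.seq h2).mono ?_, ha2, hv2, fun y hy hy' => (hf2 y hy hy').trans (hf1 y hy hy')⟩
    rw [run_var_two p s hwf.1]
    simp [cost]
  | ite c p q ihp ihq =>
    intro D r s hD ha hv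
    simp only [wf, Bool.and_eq_true] at hwf
    obtain ⟨r1, h1, ha1, hv1, e1⟩ := Term.runs_compile hd c hwf.1 D r hD
    have e : c.eval r = c.eval s := Term.eval_congr hd c hwf.1 ha hv
    have hv1' : ∀ x < d, r1.var x = s.var x := fun x hx => (hv1 x (by omega)).trans (hv x hx)
    by_cases hc : c.eval s = 0
    · obtain ⟨r2, h2, ha2, hv2, hf2⟩ := ihq hwf.2.2 D r1 s hD (ha1.trans ha) hv1'
      refine ⟨r2, (h1.seq (Runs.ite_false (by simp [Expr.eval, e1, e, hc]) h2)).mono ?_,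
        by simp [run, hc, ha2], fun y hy => by simp [run, hc, hv2 y hy],
        fun y hy hy' => (hf2 y hy hy').trans (hv1 y hy')⟩
      rw [hv 2 hd]
      simp [cost, Expr.cost]
    · obtain ⟨r2, h2, ha2, hv2, hf2⟩ := ihp hwf.2.1 D r1 s hD (ha1.trans ha) hv1'
      refine ⟨r2, (h1.seq (Runs.ite_true (by simp [Expr.eval, e1, e, hc]) h2)).mono ?_,
        by simp [run, hc, ha2], fun y hy => by simp [run, hc, hv2 y hy],
        fun y hy hy' => (hf2 y hy hy').trans (hv1 y hy')⟩
      rw [hv 2 hd]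
      simp [cost, Expr.cost]
  | each x p ih =>
    intro D r s hD ha hv
    have hwf' := hwf
    simp only [wf, Bool.and_eq_true, decide_eq_true_eq] at hwf
    obtain ⟨hx, hx2, hwf⟩ := hwf
    set N := s.var 2 with hN
    -- `F i` is the source store after `i` rounds, with which the invariant compares the machine
    -- store.
    let F := fun i => forRange (fun i s' => p.run (s'.setVar x i)) i s
    have hF (i : ℕ) : (F i).var 2 = N := by
      induction i with
      | zero => rfl
      | succ i ihi => simp [F, forRange, run_var_two p _ hwf, hx2.symm] at ihi ⊢; exact ihi
    let I : ℕ → Store → Prop := fun i q => q.arr = (F i).arr ∧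
      (∀ y < d, q.var y = (F i).var y) ∧ (∀ y, d ≤ y → y < D → q.var y = r.var y) ∧ q.var D = i
    obtain ⟨q, hq, hqa, hqv, hqf, -⟩ := Runs.count (y := D) (N := N) (T := p.cost.eval N + 6)
      (p := .seq (.assign x (.var D)) <| .seq (p.compile (D + 1)) <|
        .assign D (.add (.var D) (.const 1))) I
      (by
        rintro i - q ⟨hqa, hqv, hqf, hqD⟩
        obtain ⟨q1, h1, ha1, hv1, hf1⟩ := ih hwf (D + 1) (q.setVar x i) ((F i).setVar x i)
          (by omega) hqa (fun y hy => by simp [hqv y hy])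
        refine ⟨_, ((Runs.assign q x (.var D)).seq <| (show Runs _ _ _ _ by
          simpa [Expr.eval, hqD] using h1).seq (Runs.assign _ _ _)).mono ?_, ha1, ?_, ?_, ?_⟩
        · simp only [hF, if_neg hx2.symm]
          simp [Expr.cost]
          omega
        · intro y hy
          simp [show y ≠ D by omega, hv1 y hy, F, forRange]
        · intro y hy hy'
          simp [hy'.ne, hf1 y hy (by omega), show y ≠ x by omega, hqf y hy hy']
        · simp [Expr.eval, hf1 D hD (by omega), show D ≠ x by omega, hqD])
      (by
        rintro i q ⟨hqa, hqv, hqf, hqD⟩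
        exact ⟨hqD, (hqv 2 hd).trans (hF i)⟩) N 0 (r.setVar D 0) (by omega)
      ⟨ha, fun y hy => by simp [show y ≠ D by omega, hv y hy, F, forRange],
        fun y hy hy' => by simp [hy'.ne], by simp⟩
    refine ⟨q, ((Runs.assign r D (.const 0)).seq hq).mono ?_, hqa, hqv, hqf⟩
    simp only [Expr.cost, cost, Polynomial.eval_add, Polynomial.eval_mul, Polynomial.eval_X,
        Polynomial.eval_ofNat]
    rw [add_assoc _ 6 4]
    norm_num
    omega

end Cmd

/-! ### From commands to polynomial-time computability -/

theorem length_le_wordSize (w : List ℕ) : w.length ≤ wordSize w := by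
  induction w with
  | nil => simp
  | cons a w ih => simp [wordSize] at ih ⊢; omega

/-- The initial store for the words `ws`, with the total length of the first two of them in
variable `2`. -/
def startStore (ws : List (List ℕ)) : Store :=
  (Store.init ws).setVar 2 ((ws.getD 0 []).length + (ws.getD 1 []).length)

/-- The loop bound is at most the input size, and a polynomial over `ℕ` is monotone. The summand 4
pays for the assignment that sets the loop bound. -/
theorem polyTimeComputable_of_cmd {α : Type} {inp : α → List (List ℕ)} {out : α → List ℕ}
    (p : Cmd) (d : ℕ) (hd : 2 < d) (hwf : p.wf d)
    (h : ∀ a, (p.run (startStore (inp a))).output = out a) : PolyTimeComputable inp out := by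
  refine ⟨.seq (.assign 2 (.add (.var 0) (.var 1))) (p.compile d), 4 + p.cost, fun a => ?_⟩
  obtain ⟨r, hr, ha, hv, -⟩ := Cmd.runs_compile hd p hwf d (startStore (inp a))
    (startStore (inp a)) le_rfl rfl fun _ _ => rfl
  obtain ⟨t, ht, hx⟩ := (Runs.assign (Store.init (inp a)) 2 (.add (.var 0) (.var 1))).seq hr
  refine ⟨r, t, hx, ht.trans ?_, ?_⟩
  · have hN : (startStore (inp a)).var 2 ≤ inputSize (inp a) := by
      simp only [startStore, Store.setVar_var, if_true, inputSize]
      rcases inp a with _ | ⟨u, _ | ⟨v, l⟩⟩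
      · simp
      · simpa using length_le_wordSize u
      · have := length_le_wordSize u
        have := length_le_wordSize v
        simp
        omega
    have hmono : p.cost.eval ((startStore (inp a)).var 2) ≤ p.cost.eval (inputSize (inp a)) := by
      simp only [Polynomial.eval_eq_sum, Polynomial.sum]
      gcongr
    simp only [Expr.cost, Polynomial.eval_add, Polynomial.eval_ofNat]
    omega
  · rw [← h a]
    simp only [Store.output, ha, hv 0 (by omega)]

/-! ### Auctions for the assignment problem -/

open Classical in
/-- The least number below `N` with the property `P`, and `N` if there is none. -/
noncomputable def leastBelow (N : ℕ) (P : ℕ → Prop) : ℕ :=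
  ∑ i ∈ Finset.range N, if ∃ k < N, k ≤ i ∧ P k then 0 else 1

theorem leastBelow_of_forall_not {N : ℕ} {P : ℕ → Prop} (h : ∀ k < N, ¬ P k) :
    leastBelow N P = N := by
  rw [leastBelow, Finset.sum_congr rfl fun i _ => if_neg fun ⟨k, hk, _, hP⟩ => h k hk hP]
  simp

/-- The summand is 1 exactly for the indices before the first witness, so the sum counts up to that
witness. -/
theorem leastBelow_of_exists {N : ℕ} {P : ℕ → Prop} (h : ∃ k < N, P k) :
    leastBelow N P < N ∧ P (leastBelow N P) := by
  classical
  obtain ⟨hl, hP⟩ := Nat.find_spec h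
  have : leastBelow N P = Nat.find h := by
    have h1 : ∀ i ∈ Finset.range N, (if ∃ k < N, k ≤ i ∧ P k then 0 else 1) =
        if i ∈ Finset.range (Nat.find h) then 1 else 0 := fun i hi => by
      by_cases hif : i < Nat.find h
      · rw [if_neg fun ⟨k, hk, hki, hPk⟩ => Nat.find_min h (m := k) (by omega) ⟨hk, hPk⟩,
          if_pos (Finset.mem_range.2 hif)]
      · rw [if_pos ⟨_, hl, by omega, hP⟩, if_neg (by simpa using hif)]
    rw [leastBelow, Finset.sum_congr rfl h1, Finset.sum_ite_mem,
      Finset.inter_eq_right.2 (Finset.range_subset_range.2 hl.le)]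
    simp
  exact this ▸ ⟨hl, hP⟩

theorem leastBelow_congr {N : ℕ} {P Q : ℕ → Prop} (h : ∀ k, P k ↔ Q k) :
    leastBelow N P = leastBelow N Q := by
  rw [show P = Q from funext fun k => propext (h k)]

open Classical in
/-- One bid: the least bidder without an object bids for the least best object `j` at the current
prices, gets it, and its price grows by one. A state consists of the owners, shifted by one, and
the prices. -/
noncomputable def bid (N n : ℕ) (W : ℕ → ℕ → ℕ) (st : (ℕ → ℕ) × (ℕ → ℕ)) :
    (ℕ → ℕ) × (ℕ → ℕ) :=
  let i := leastBelow N fun i => i < n ∧ ∀ j < n, st.1 j ≠ i + 1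
  let j := leastBelow N fun j => j < n ∧ ∀ k < n, W i k + st.2 j ≤ W i j + st.2 k
  if i < n then (Function.update st.1 j (i + 1), Function.update st.2 j (st.2 j + 1)) else st

/-- The state after `m` bids. -/
noncomputable def auction (N n : ℕ) (W : ℕ → ℕ → ℕ) (m : ℕ) : (ℕ → ℕ) × (ℕ → ℕ) :=
  (bid N n W)^[m] (fun _ => 0, fun _ => 0)

/-- The object of bidder `i`. -/
noncomputable def wonBy (N n : ℕ) (o : ℕ → ℕ) (i : ℕ) : ℕ :=
  leastBelow N fun j => j < n ∧ o j = i + 1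

/-- The invariants of an auction, among them that nobody can gain more than one by another
object. -/
structure AuctionInv (n C : ℕ) (W : ℕ → ℕ → ℕ) (st : (ℕ → ℕ) × (ℕ → ℕ)) : Prop where
  le : ∀ j < n, st.1 j ≤ n
  inj : ∀ j < n, ∀ j' < n, st.1 j ≠ 0 → st.1 j = st.1 j' → j = j'
  happy : ∀ i, ∀ j < n, st.1 j = i + 1 → ∀ k < n, W i k + st.2 j ≤ W i j + st.2 k + 1
  free : ∀ j < n, st.1 j = 0 → st.2 j = 0
  price : ∀ j < n, st.2 j ≤ C + 1

/-- Pigeonhole: if all `n` objects had owners, two would belong to the same one of the remaining `n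
- 1` bidders. -/
theorem AuctionInv.exists_free {n C : ℕ} {W : ℕ → ℕ → ℕ} {st : (ℕ → ℕ) × (ℕ → ℕ)}
    (h : AuctionInv n C W st) {i : ℕ} (hi : i < n) (hfree : ∀ j < n, st.1 j ≠ i + 1) :
    ∃ k < n, st.1 k = 0 := by
  by_contra! hne
  have hcard : ((Finset.Icc 1 n).erase (i + 1)).card < (Finset.range n).card := by
    rw [Finset.card_erase_of_mem (by simp; omega)]
    simp
    omega
  obtain ⟨a, ha, b, hb, hab, he⟩ := Finset.exists_ne_map_eq_of_card_lt_of_maps_to hcard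
    (f := st.1) fun j hj => by
      have hj := Finset.mem_range.1 hj
      have := h.le j hj
      have := hne j hj
      simp [hfree j hj]
      omega
  exact hab (h.inj a (Finset.mem_range.1 ha) b (Finset.mem_range.1 hb)
    (hne a (Finset.mem_range.1 ha)) he)

/-- The object maximizes `w - p` over the integers. The prices are moved to the other side since
subtraction on `ℕ` truncates. -/
theorem exists_best_object {n : ℕ} (hn : 0 < n) (w p : ℕ → ℕ) :
    ∃ j < n, ∀ k < n, w k + p j ≤ w j + p k := by
  obtain ⟨j, hj, hmax⟩ := Finset.exists_max_image (Finset.range n)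
    (fun j => (w j : ℤ) - p j) ⟨0, by simpa using hn⟩
  refine ⟨j, by simpa using hj, fun k hk => ?_⟩
  have := hmax k (by simpa using hk)
  omega

/-- The bidder takes an object that is best at the current prices, so raising its price by one
leaves a regret of at most one, and later raises of other prices only help. The sum of the prices
measures progress: every genuine bid increases it by one. -/
theorem AuctionInv.bid {N n C : ℕ} {W : ℕ → ℕ → ℕ} (hN : n ≤ N)
    (hC : ∀ i < n, ∀ k < n, W i k ≤ C) {st : (ℕ → ℕ) × (ℕ → ℕ)} (h : AuctionInv n C W st) :
    AuctionInv n C W (bid N n W st) ∧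
      ((∀ i < n, ∃ j < n, st.1 j = i + 1) ∧ TropicalExchange.bid N n W st = st ∨
        ∑ j ∈ Finset.range n, (TropicalExchange.bid N n W st).2 j =
          ∑ j ∈ Finset.range n, st.2 j + 1) := by
  unfold TropicalExchange.bid
  dsimp only
  set i := leastBelow N fun i => i < n ∧ ∀ j < n, st.1 j ≠ i + 1 with hi
  set j := leastBelow N fun j => j < n ∧ ∀ k < n, W i k + st.2 j ≤ W i j + st.2 k with hj
  split_ifs with hin
  swap
  · refine ⟨h, .inl ⟨fun i' hi' => ?_, rfl⟩⟩
    by_contra! hne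
    exact hin (leastBelow_of_exists (P := fun i => i < n ∧ ∀ j < n, st.1 j ≠ i + 1)
      ⟨i', by omega, hi', hne⟩).2.1
  have hfree : ∀ j < n, st.1 j ≠ i + 1 := by
    by_contra hne
    have : i = N := leastBelow_of_forall_not fun k hk hP => by
      exact hne (leastBelow_of_exists (P := fun i => i < n ∧ ∀ j < n, st.1 j ≠ i + 1)
        ⟨k, hk, hP⟩).2.2
    omega
  obtain ⟨b, hb, hbest⟩ := exists_best_object (n := n) (by omega) (W i) st.2
  obtain ⟨-, hjn, hjb⟩ := leastBelow_of_exists (N := N)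
    (P := fun j => j < n ∧ ∀ k < n, W i k + st.2 j ≤ W i j + st.2 k) ⟨b, by omega, hb, hbest⟩
  rw [← hj] at hjn hjb
  obtain ⟨f, hf, hf0⟩ := h.exists_free hin hfree
  constructor
  · constructor
    · intro a ha
      by_cases haj : a = j
      · subst haj; simp; omega
      · simpa [haj] using h.le a ha
    · intro a ha a' ha'
      by_cases haj : a = j <;> by_cases haj' : a' = j
      · intro _ _; rw [haj, haj']
      · simp only [haj, Function.update_self, Function.update_of_ne haj']
        intro _ he
        exact absurd he.symm (hfree a' ha')
      · simp only [haj', Function.update_self, Function.update_of_ne haj]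
        intro _ he
        exact absurd he (hfree a ha)
      · simpa [haj, haj'] using h.inj a ha a' ha'
    · intro l a ha hl k hk
      have hmono : st.2 k ≤ Function.update st.2 j (st.2 j + 1) k := by
        by_cases hkj : k = j
        · subst hkj; simp
        · simp [hkj]
      by_cases haj : a = j
      · subst haj
        have hl' : i = l := by simpa using hl
        subst hl'
        have := hjb k hk
        simp only [Function.update_self]
        omega
      · have := h.happy l a ha (by simpa [haj] using hl) k hk
        simp only [Function.update_of_ne haj]
        omega
    · intro a ha
      by_cases haj : a = j
      · subst haj; simp
      · simpa [haj] using h.free a ha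
    · intro a ha
      by_cases haj : a = j
      -- Some object `f` is still free and costs nothing. Since `j` is at least as good for the
      -- bidder, its old price is at most `C`.
      · subst haj
        have h1 := hjb f hf
        have h2 := hC i hin _ hjn
        have h3 := h.free f hf hf0
        simp only [Function.update_self]
        omega
      · simpa [haj] using h.price a ha
  · right
    rw [← Finset.add_sum_erase _ _ (Finset.mem_range.2 hjn),
      ← Finset.add_sum_erase _ (fun j => st.2 j) (Finset.mem_range.2 hjn)]
    rw [Finset.sum_congr rfl (g := fun j => st.2 j) fun a ha => Function.update_of_ne
      (Finset.ne_of_mem_erase ha) _ _]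
    simp
    omega

/-- As long as somebody has no object, the sum of the prices counts the bids; once everybody is
served, the state no longer changes. Together with the price bound this gives termination. -/
theorem auction_inv {N n C : ℕ} {W : ℕ → ℕ → ℕ} (hN : n ≤ N)
    (hC : ∀ i < n, ∀ k < n, W i k ≤ C) (m : ℕ) :
    AuctionInv n C W (auction N n W m) ∧
      ((∀ i < n, ∃ j < n, (auction N n W m).1 j = i + 1) ∨
        m ≤ ∑ j ∈ Finset.range n, (auction N n W m).2 j) := by
  induction m with
  | zero =>
    refine ⟨⟨?_, ?_, ?_, ?_, ?_⟩, .inr (Nat.zero_le _)⟩ <;> simp [auction]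
  | succ m ih =>
    obtain ⟨h, hm⟩ := ih
    obtain ⟨h', hm'⟩ := h.bid hN hC
    have e : auction N n W (m + 1) = bid N n W (auction N n W m) :=
      Function.iterate_succ_apply' _ _ _
    rw [e]
    refine ⟨h', ?_⟩
    rcases hm' with ⟨hall, he⟩ | hs
    · rw [he]; exact .inl hall
    · rw [hs]
      rcases hm with hall | hm
      · left
        unfold bid
        dsimp only
        rw [if_neg]
        · exact hall
        · rw [leastBelow_of_forall_not]
          · omega
          · rintro k - ⟨hk, hne⟩
            obtain ⟨j, hj, he⟩ := hall k hk
            exact hne j hj he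
      · right; omega

/-- After sufficiently many bids, the objects are assigned, and the total value is within `n` of
the optimum. -/
theorem exists_perm_of_auction {N n C m : ℕ} {W : ℕ → ℕ → ℕ} (hN : n ≤ N)
    (hC : ∀ i < n, ∀ k < n, W i k ≤ C) (hm : n * (C + 1) < m) :
    ∃ σ : Equiv.Perm (Fin n), (∀ i : Fin n, wonBy N n (auction N n W m).1 i = σ i) ∧
      ∀ τ : Equiv.Perm (Fin n), ∑ i : Fin n, W i (τ i) ≤ ∑ i : Fin n, W i (σ i) + n := by
  obtain ⟨h, hm'⟩ := auction_inv hN hC m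
  set st := auction N n W m
  have hall : ∀ i < n, ∃ j < n, st.1 j = i + 1 := by
    -- The `n` objects, each at a price of at most `C + 1`, can absorb only `n * (C + 1)` bids,
    -- which is less than `m`.
    refine hm'.resolve_right fun hle => ?_
    have := hle.trans (Finset.sum_le_card_nsmul _ _ _ fun j hj =>
      h.price j (Finset.mem_range.1 hj))
    simp at this
    omega
  have hwon (i : Fin n) : wonBy N n st.1 i < n ∧ st.1 (wonBy N n st.1 i) = i + 1 := by
    obtain ⟨j, hj, he⟩ := hall i i.2
    exact (leastBelow_of_exists (P := fun j => j < n ∧ st.1 j = i + 1) ⟨j, by omega, hj, he⟩).2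
  let f : Fin n → Fin n := fun i => ⟨wonBy N n st.1 i, (hwon i).1⟩
  have hf : Function.Injective f := fun a b hab => by
    have h1 := (hwon a).2
    have h2 := (hwon b).2
    have : wonBy N n st.1 a = wonBy N n st.1 b := congrArg Fin.val hab
    rw [this] at h1
    exact Fin.ext (by omega)
  refine ⟨Equiv.ofBijective f (Finite.injective_iff_bijective.1 hf), fun i => rfl, fun τ => ?_⟩
  set σ : Equiv.Perm (Fin n) := Equiv.ofBijective f (Finite.injective_iff_bijective.1 hf)
  -- Both assignments use each object once, so the prices cancel in the sum and only the slack of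
  -- one per bidder remains.
  have key : ∑ i : Fin n, (W i (τ i) + st.2 (σ i)) ≤ ∑ i : Fin n, (W i (σ i) + st.2 (τ i) + 1) :=
    Finset.sum_le_sum fun i _ => h.happy i _ (σ i).2 (hwon i).2 _ (τ i).2
  simp only [Finset.sum_add_distrib] at key
  rw [Equiv.sum_comp σ fun i : Fin n => st.2 i, Equiv.sum_comp τ fun i : Fin n => st.2 i] at key
  simp at key
  omega

/-! ### Exchanges as permutations -/

/-- The adjacency of a digraph on `0, …, n - 1` as a relation on numbers. -/
def natAdj {n : ℕ} (G : Digraph (Fin n)) (i k : ℕ) : Prop :=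
  ∃ (hi : i < n) (hk : k < n), G.Adj ⟨i, hi⟩ ⟨k, hk⟩

@[simp] theorem natAdj_val {n : ℕ} (G : Digraph (Fin n)) (i k : Fin n) :
    natAdj G i k ↔ G.Adj i k := by
  simp [natAdj]

open Classical in
/-- The value of the object `k` for the bidder `i`. -/
noncomputable def weight {n : ℕ} (G : Digraph (Fin n)) (i k : ℕ) : ℕ :=
  if natAdj G i k then (n + 1) * (n + 1) else if i = k then n * (n + 1) else 0

/-- The permutation only moves vertices along arcs. -/
def Follows {V : Type*} (G : Digraph V) (σ : Equiv.Perm V) : Prop :=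
  ∀ i, G.Adj i (σ i) ∨ σ i = i

open Classical in
/-- The number of vertices that the permutation moves along an arc. -/
noncomputable def numArcs {V : Type*} [Fintype V] (G : Digraph V) (σ : Equiv.Perm V) : ℕ :=
  (Finset.univ.filter fun i => G.Adj i (σ i)).card

theorem sum_weight {n : ℕ} (G : Digraph (Fin n)) {σ : Equiv.Perm (Fin n)} (h : Follows G σ) :
    ∑ i : Fin n, weight G i (σ i) = n * (n * (n + 1)) + numArcs G σ * (n + 1) := by
  classical
  have (i : Fin n) : weight G i (σ i) = n * (n + 1) + if G.Adj i (σ i) then (n + 1) else 0 := by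
    unfold weight
    rcases h i with h | h
    · simp [h]; ring
    · by_cases h' : G.Adj i (σ i)
      · simp [h']; ring
      · simp only [natAdj_val, h', if_false]
        simp [h]
  simp only [this, Finset.sum_add_distrib]
  rw [← Finset.sum_filter, Finset.sum_const, smul_eq_mul, numArcs]
  simp only [Finset.card_univ, Fintype.card_fin, smul_eq_mul, Finset.sum_const]

/-- One more arc is worth `n + 1`, more than the error `n` of the auction, so the near-optimal
assignment is optimal. The bound on `N` makes `N * N` bids enough for weights up to `(n + 1) * (n +
1)`. -/
theorem exists_perm_of_auction_weight {n N : ℕ} (G : Digraph (Fin n)) (hN : 1 + n + n * n ≤ N) :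
    ∃ σ : Equiv.Perm (Fin n),
      (∀ i : Fin n, wonBy N n (auction N n (weight G) (N * N)).1 i = σ i) ∧ Follows G σ ∧
      ∀ τ, Follows G τ → numArcs G τ ≤ numArcs G σ := by
  classical
  have hC (i k : ℕ) : weight G i k ≤ (n + 1) * (n + 1) := by
    unfold weight
    split_ifs <;> nlinarith
  have hN2 : (1 + n + n * n) * (1 + n + n * n) ≤ N * N := Nat.mul_le_mul hN hN
  have hN3 : n * ((n + 1) * (n + 1) + 1) < (1 + n + n * n) * (1 + n + n * n) := by
    nlinarith [Nat.zero_le (n * n * n), Nat.zero_le (n * n), Nat.zero_le (n * n * n * n)]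
  obtain ⟨σ, hσ, hopt⟩ := exists_perm_of_auction (N := N) (n := n) (m := N * N) (W := weight G)
    (by nlinarith) (fun i _ k _ => hC i k) (hN3.trans_le hN2)
  have hF : Follows G σ := by
    by_contra hF
    simp only [Follows, not_forall, not_or] at hF
    obtain ⟨i, hi, hi'⟩ := hF
    -- One worthless pair leaves a total of at most `(n - 1) * (n + 1)^2`, which is `n + 1` below
    -- the value `n^2 * (n + 1)` that the identity guarantees; the auction loses at most `n`.
    have h1 := hopt 1
    have h2 : ∑ i : Fin n, weight G i (σ i) ≤ (n - 1) * ((n + 1) * (n + 1)) := by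
      rw [← Finset.add_sum_erase _ _ (Finset.mem_univ i)]
      have h0 : weight G i (σ i) = 0 := by
        have : (i : ℕ) ≠ σ i := fun h => hi' (Fin.ext h.symm)
        simp [weight, hi, this]
      rw [h0, zero_add]
      refine (Finset.sum_le_card_nsmul _ (fun j : Fin n => weight G j (σ j)) _
        fun j _ => hC j _).trans ?_
      rw [Finset.card_erase_of_mem (Finset.mem_univ i)]
      simp
    rw [sum_weight G fun i => .inr rfl] at h1
    have hn : 0 < n := i.pos
    obtain ⟨n', rfl⟩ : ∃ n', n = n' + 1 := ⟨n - 1, by omega⟩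
    rw [Nat.add_sub_cancel] at h2
    nlinarith [Nat.zero_le (numArcs G 1 * (n' + 1 + 1))]
  refine ⟨σ, hσ, hF, fun τ hτ => ?_⟩
  have h1 := hopt τ
  rw [sum_weight G hτ, sum_weight G hF] at h1
  by_contra! hlt
  nlinarith

/-! ### From exchanges to permutations -/

theorem IsDicycle.adj_formPerm {V : Type*} [DecidableEq V] {G : Digraph V} {c : List V}
    (h : IsDicycle G c) {v : V} (hv : v ∈ c) : G.Adj v (c.formPerm v) := by
  obtain ⟨-, hn, hch⟩ := h
  obtain ⟨i, hi, rfl⟩ := List.getElem_of_mem hv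
  rw [List.formPerm_apply_getElem _ hn]
  cases c with
  | nil => simp at hi
  | cons a l =>
    rw [Cycle.chain_coe_cons, List.isChain_iff_getElem] at hch
    -- The chain condition concerns the closed list `a :: l ++ [a]`; the entry after the last vertex
    -- is `a`, in accordance with the wrap-around of `formPerm`.
    have := hch i (by simpa using hi)
    simp only [← List.cons_append] at this
    rw [List.getElem_append_left hi] at this
    by_cases hl : i + 1 < (a :: l).length
    · rw [List.getElem_append_left hl] at this
      simpa only [Nat.mod_eq_of_lt hl] using this
    · have hl' : i + 1 = (a :: l).length := by omega
      rw [List.getElem_append_right (by omega)] at this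
      simpa [hl'] using this

/-- The permutation is the product of the `formPerm` of the cycles, whose supports do not interfere.
A one-vertex cycle contributes the identity, and its vertex still has an arc to its image because of
the loop. -/
theorem exists_perm_of_cycles {V : Type*} [DecidableEq V] {G : Digraph V} (T : List (List V))
    (h : ∀ c ∈ T, IsDicycle G c) (hd : T.Pairwise List.Disjoint) :
    ∃ τ : Equiv.Perm V, (∀ v ∈ T.flatten, G.Adj v (τ v)) ∧ ∀ v ∉ T.flatten, τ v = v := by
  induction T with
  | nil => exact ⟨1, by simp⟩
  | cons c T ih =>
    rw [List.pairwise_cons] at hd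
    obtain ⟨τ, h1, h2⟩ := ih (fun c hc => h c (List.mem_cons_of_mem _ hc)) hd.2
    have hcT : ∀ v ∈ c, v ∉ T.flatten := fun v hv hv' => by
      obtain ⟨d, hdT, hvd⟩ := List.mem_flatten.1 hv'
      exact hd.1 d hdT hv hvd
    have hτ : ∀ v ∈ T.flatten, τ v ∈ T.flatten := fun v hv => by
      by_contra hne
      exact hne (by rwa [τ.injective (h2 _ hne)])
    refine ⟨c.formPerm * τ, fun v hv => ?_, fun v hv => ?_⟩
    · rw [List.flatten_cons, List.mem_append] at hv
      rw [Equiv.Perm.mul_apply]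
      by_cases hvc : v ∈ c
      · rw [h2 v (hcT v hvc)]
        exact (h c List.mem_cons_self).adj_formPerm hvc
      · have hv := hv.resolve_left hvc
        rw [List.formPerm_apply_of_notMem fun hc => hcT _ hc (hτ v hv)]
        exact h1 v hv
    · rw [List.flatten_cons, List.mem_append, not_or] at hv
      rw [Equiv.Perm.mul_apply, h2 v hv.2, List.formPerm_apply_of_notMem hv.1]

theorem IsExchange.exists_perm {V : Type*} [DecidableEq V] [Fintype V] {G : Digraph V}
    {T : List (List V)} (h : IsExchange G T) :
    ∃ τ : Equiv.Perm V, Follows G τ ∧ (verts T).card ≤ numArcs G τ := by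
  obtain ⟨τ, h1, h2⟩ := exists_perm_of_cycles T h.1 h.2
  refine ⟨τ, fun v => ?_, Finset.card_le_card fun v hv => ?_⟩
  · by_cases hv : v ∈ T.flatten
    exacts [.inl (h1 v hv), .inr (h2 v hv)]
  · simpa using h1 v (List.mem_toFinset.1 hv)

/-! ### From permutations to exchanges -/

/-- The cycle of the vertex `v` in a permutation. -/
noncomputable def orbitList {V : Type*} (σ : Equiv.Perm V) (v : V) : List V :=
  (List.range (Function.minimalPeriod σ v)).map fun i => σ^[i] v

theorem mem_orbitList {V : Type*} [Finite V] {σ : Equiv.Perm V} {u v : V} :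
    u ∈ orbitList σ v ↔ σ.SameCycle v u := by
  have hp : v ∈ Function.periodicPts σ := σ.injective.mem_periodicPts v
  have := Function.mem_periodicOrbit_iff (y := u) hp
  rw [Function.periodicOrbit_def, Cycle.mem_coe_iff] at this
  rw [orbitList, this]
  constructor
  · rintro ⟨k, rfl⟩
    exact ⟨k, by simp [Equiv.Perm.iterate_eq_pow]⟩
  · intro h
    obtain ⟨k, hk⟩ := h.exists_nat_pow_eq
    exact ⟨k, by rw [Equiv.Perm.iterate_eq_pow, hk]⟩

/-- If some iterate were a fixed point, then by injectivity `v` itself would be fixed, and the arc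
at `v` is a loop that serves every iterate. -/
theorem Follows.adj_iterate {V : Type*} {G : Digraph V} {σ : Equiv.Perm V} (h : Follows G σ)
    {v : V} (hv : G.Adj v (σ v)) (k : ℕ) : G.Adj (σ^[k] v) (σ (σ^[k] v)) := by
  refine (h _).elim id fun hk => ?_
  rw [← Function.iterate_succ_apply' σ, Function.iterate_succ_apply] at hk
  have hv' : σ v = v := σ.injective.iterate k hk
  have (i : ℕ) : σ^[i] v = v := Function.iterate_fixed hv' i
  rw [this k]
  exact hv

theorem Follows.isDicycle_orbitList {V : Type*} [Finite V] {G : Digraph V} {σ : Equiv.Perm V}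
    (h : Follows G σ) {v : V} (hv : G.Adj v (σ v)) : IsDicycle G (orbitList σ v) := by
  refine ⟨List.ne_nil_of_mem (mem_orbitList.2 (.refl σ v)), ?_, ?_⟩
  · exact Function.nodup_periodicOrbit (f := σ) (x := v)
  · refine (Function.periodicOrbit_chain G.Adj (f := σ) (x := v)).2 fun k _ => ?_
    rw [Function.iterate_succ_apply']
    exact h.adj_iterate hv k

open Classical in
/-- The cycles of the permutation `σ` through the vertices below `m`, except for the fixed points
without a loop. -/
noncomputable def cyclesOf {n : ℕ} (G : Digraph (Fin n)) (σ : Equiv.Perm (Fin n)) :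
    ℕ → List (List (Fin n))
  | 0 => []
  | m + 1 =>
    if h : ∃ hm : m < n, G.Adj ⟨m, hm⟩ (σ ⟨m, hm⟩) ∧ ⟨m, hm⟩ ∉ (cyclesOf G σ m).flatten then
      cyclesOf G σ m ++ [orbitList σ ⟨m, h.1⟩]
    else cyclesOf G σ m

theorem mem_cyclesOf {n : ℕ} {G : Digraph (Fin n)} {σ : Equiv.Perm (Fin n)} {c : List (Fin n)}
    {m : ℕ} (hc : c ∈ cyclesOf G σ m) : ∃ v, G.Adj v (σ v) ∧ c = orbitList σ v := by
  induction m with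
  | zero => simp [cyclesOf] at hc
  | succ m ih =>
    rw [cyclesOf] at hc
    split_ifs at hc with h
    · rcases List.mem_append.1 hc with hc | hc
      · exact ih hc
      · exact ⟨_, h.2.1, List.mem_singleton.1 hc⟩
    · exact ih hc

/-- Orbits that meet coincide, so an orbit that meets an earlier one would have its starting vertex
covered already. -/
theorem pairwise_cyclesOf {n : ℕ} (G : Digraph (Fin n)) (σ : Equiv.Perm (Fin n)) (m : ℕ) :
    (cyclesOf G σ m).Pairwise List.Disjoint := by
  induction m with
  | zero => simp [cyclesOf]
  | succ m ih =>
    rw [cyclesOf]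
    split_ifs with h
    · refine List.pairwise_append.2 ⟨ih, List.pairwise_singleton _ _, fun c hc d hd u huc hud => ?_⟩
      rw [List.mem_singleton.1 hd, mem_orbitList] at hud
      refine h.2.2 (List.mem_flatten.2 ⟨c, hc, ?_⟩)
      obtain ⟨v, -, rfl⟩ := mem_cyclesOf hc
      rw [mem_orbitList] at huc ⊢
      exact huc.trans hud.symm
    · exact ih

theorem mem_flatten_cyclesOf {n : ℕ} {G : Digraph (Fin n)} {σ : Equiv.Perm (Fin n)} {m : ℕ}
    {v : Fin n} (hm : v < m) (hv : G.Adj v (σ v)) : v ∈ (cyclesOf G σ m).flatten := by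
  induction m with
  | zero => omega
  | succ m ih =>
    rw [cyclesOf]
    by_cases hvm : (v : ℕ) < m
    · split_ifs with h
      · rw [List.flatten_append, List.mem_append]
        exact .inl (ih hvm)
      · exact ih hvm
    · obtain rfl : m = v := by omega
      split_ifs with h
      · rw [List.flatten_append, List.mem_append]
        right
        simpa using mem_orbitList.2 (.refl σ v)
      · by_contra hne
        exact h ⟨v.2, hv, hne⟩

theorem Follows.isExchange_cyclesOf {n : ℕ} {G : Digraph (Fin n)} {σ : Equiv.Perm (Fin n)}
    (h : Follows G σ) (m : ℕ) : IsExchange G (cyclesOf G σ m) := by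
  refine ⟨fun c hc => ?_, pairwise_cyclesOf G σ m⟩
  obtain ⟨v, hv, rfl⟩ := mem_cyclesOf hc
  exact h.isDicycle_orbitList hv

theorem Follows.card_verts_cyclesOf {n : ℕ} {G : Digraph (Fin n)} {σ : Equiv.Perm (Fin n)}
    (h : Follows G σ) : (verts (cyclesOf G σ n)).card = numArcs G σ := by
  classical
  rw [numArcs]
  congr 1
  ext u
  simp only [verts, List.mem_toFinset, Finset.mem_filter, Finset.mem_univ, true_and]
  refine ⟨fun hu => ?_, fun hu => mem_flatten_cyclesOf u.2 hu⟩
  obtain ⟨c, hc, hu⟩ := List.mem_flatten.1 hu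
  obtain ⟨v, hv, rfl⟩ := mem_cyclesOf hc
  obtain ⟨k, -, rfl⟩ := List.mem_map.1 hu
  exact h.adj_iterate hv k

/-- The cycles of an optimal permutation form an optimal exchange. -/
theorem isMaxSizeExchange_cyclesOf {n : ℕ} {G : Digraph (Fin n)} {σ : Equiv.Perm (Fin n)}
    (h : Follows G σ) (hopt : ∀ τ, Follows G τ → numArcs G τ ≤ numArcs G σ) :
    IsMaxSizeExchange G (cyclesOf G σ n) := by
  refine ⟨h.isExchange_cyclesOf n, fun T hT => ?_⟩
  obtain ⟨τ, hτ, hcard⟩ := hT.exists_perm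
  exact hcard.trans ((hopt τ hτ).trans h.card_verts_cyclesOf.ge)

/-- This reduces maximality, a statement about all exchanges, to one comparison with a computed
optimum. -/
theorem IsExchange.isMaxSizeExchange_iff {n : ℕ} {G : Digraph (Fin n)} {σ : Equiv.Perm (Fin n)}
    (h : Follows G σ) (hopt : ∀ τ, Follows G τ → numArcs G τ ≤ numArcs G σ)
    {S : List (List (Fin n))} (hS : IsExchange G S) :
    IsMaxSizeExchange G S ↔ numArcs G σ ≤ (verts S).card := by
  have hσ := isMaxSizeExchange_cyclesOf h hopt
  rw [← h.card_verts_cyclesOf]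
  exact ⟨fun hS => hS.2 _ hσ.1, fun hle => ⟨hS, fun T hT => (hσ.2 T hT).trans hle⟩⟩

/-! ### Approximation -/

/-- Colors of `T` ≤ vertices of `T` ≤ vertices of `S` ≤ `j` times colors of `S`, the last because
color classes have at most `j` vertices. -/
theorem numColors_le_mul {n j : ℕ} {color : Fin n → ℕ}
    (hj : ∀ c : ℕ, (Finset.univ.filter fun v => color v = c).card ≤ j)
    {S T : List (List (Fin n))} (h : (verts T).card ≤ (verts S).card) :
    numColors color T ≤ j * numColors color S := by
  refine Finset.card_image_le.trans (h.trans ?_)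
  refine Finset.card_le_mul_card_image _ _ fun c _ => (Finset.card_le_card ?_).trans (hj c)
  exact Finset.filter_subset_filter _ (Finset.subset_univ _)

theorem isApprox_of_solves {j : ℕ} {A : DigraphProcedure} (hA : SolvesMaxSizeExchange A) :
    (jPCTEx j).IsApprox j (ignoreColors A) ∧ (jPCTMaxEx j).IsApprox j (ignoreColors A) := by
  refine ⟨fun x => ⟨(hA _ _).1, fun y hy => ?_⟩, fun x => ⟨hA _ _, fun y hy => ?_⟩⟩
  · exact_mod_cast numColors_le_mul x.2 ((hA _ _).2 y hy)
  · exact_mod_cast numColors_le_mul x.2 ((hA _ _).2 y hy.1)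

/-! ### Derived terms -/

namespace Term

/-- The truth of a term as a test. -/
def Holds (a : Term) (s : Store) : Prop := a.eval s ≠ 0

/-- Negation. -/
def not (a : Term) : Term := .ite a (.const 0) (.const 1)

/-- Conjunction. -/
def and (a b : Term) : Term := .ite a b (.const 0)

/-- Implication. -/
def imp (a b : Term) : Term := .ite a b (.const 1)

/-- The test `a < b`. -/
def lt (a b : Term) : Term := .sub b a

/-- The test `a ≤ b`. -/
def le (a b : Term) : Term := .not (.sub a b)

/-- The test `a = b`. -/
def eq (a b : Term) : Term := .and (.le a b) (.le b a)

/-- Bounded universal quantification. -/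
def all (x : ℕ) (a : Term) : Term := .not (.sum x (.not a))

/-- The least value of `x` with the property `a`; the auxiliary variable `y` must not occur
in `a`. -/
def least (x y : ℕ) (a : Term) : Term := .sum y (.not (.sum x (.and (.le (.var x) (.var y)) a)))

variable (a b c : Term) (s : Store)

@[simp] theorem eval_const (k : ℕ) : (const k).eval s = k := rfl

@[simp] theorem eval_var (x : ℕ) : (var x).eval s = s.var x := rfl

@[simp] theorem eval_add : (add a b).eval s = a.eval s + b.eval s := rfl

@[simp] theorem eval_sub : (sub a b).eval s = a.eval s - b.eval s := rfl

@[simp] theorem eval_get (k : ℕ) : (get k a).eval s = s.arr k (a.eval s) := rfl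

open Classical in
@[simp] theorem eval_ite : (ite c a b).eval s = if c.Holds s then a.eval s else b.eval s := by
  by_cases h : c.eval s = 0 <;> simp [eval, Holds, h]

@[simp] theorem eval_sum (x : ℕ) :
    (sum x a).eval s = ∑ i ∈ Finset.range (s.var 2), a.eval (s.setVar x i) := rfl

@[simp] theorem holds_const (k : ℕ) : (const k).Holds s ↔ k ≠ 0 := Iff.rfl

@[simp] theorem holds_var (x : ℕ) : (var x).Holds s ↔ s.var x ≠ 0 := Iff.rfl

@[simp] theorem holds_get (k : ℕ) : (get k a).Holds s ↔ s.arr k (a.eval s) ≠ 0 := Iff.rfl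

@[simp] theorem holds_not : (not a).Holds s ↔ ¬ a.Holds s := by
  simp only [not, Holds, eval]
  split_ifs <;> simp_all

@[simp] theorem holds_and : (and a b).Holds s ↔ a.Holds s ∧ b.Holds s := by
  simp only [and, Holds, eval]
  split_ifs <;> simp_all

@[simp] theorem holds_imp : (imp a b).Holds s ↔ (a.Holds s → b.Holds s) := by
  simp only [imp, Holds, eval]
  split_ifs <;> simp_all

@[simp] theorem holds_lt : (lt a b).Holds s ↔ a.eval s < b.eval s := by
  simp [lt, Holds, Nat.sub_eq_zero_iff_le]

@[simp] theorem holds_le : (le a b).Holds s ↔ a.eval s ≤ b.eval s := by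
  simp only [le, holds_not]
  simp [Holds, Nat.sub_eq_zero_iff_le]

@[simp] theorem holds_eq : (eq a b).Holds s ↔ a.eval s = b.eval s := by
  simp [eq, le_antisymm_iff]

@[simp] theorem holds_sum (x : ℕ) :
    (sum x a).Holds s ↔ ∃ i < s.var 2, a.Holds (s.setVar x i) := by
  simp [Holds]

@[simp] theorem holds_all (x : ℕ) :
    (all x a).Holds s ↔ ∀ i < s.var 2, a.Holds (s.setVar x i) := by
  simp [all]

/-- That `P` does not depend on the value `i` of the auxiliary variable is a semantic substitute for
a freshness check. -/
theorem eval_least {x y : ℕ} (hxy : x ≠ y) (P : ℕ → Prop) (hy : y ≠ 2)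
    (h : ∀ i k, a.Holds ((s.setVar y i).setVar x k) ↔ P k) :
    (least x y a).eval s = leastBelow (s.var 2) P := by
  classical
  simp only [least, eval_sum, leastBelow, not, eval_ite, holds_sum, holds_and, holds_le, h,
    Store.setVar_var, eval_var, if_true, hxy.symm, hy.symm, if_false, eval_const]

end Term

theorem forRange_induction {α : Type*} {f : ℕ → α → α} {a : α} {n : ℕ} (P : ℕ → α → Prop)
    (h0 : P 0 a) (h : ∀ i < n, ∀ b, P i b → P (i + 1) (f i b)) : P n (forRange f n a) := by
  induction n with
  | zero => exact h0
  | succ n ih => exact h n (by omega) _ (ih fun i hi => h i (by omega))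

namespace Cmd

@[simp] theorem run_skip (s : Store) : skip.run s = s := rfl

@[simp] theorem run_assign (x : ℕ) (a : Term) (s : Store) :
    (assign x a).run s = s.setVar x (a.eval s) := rfl

@[simp] theorem run_put (k : ℕ) (i a : Term) (s : Store) :
    (put k i a).run s = s.setArr k (i.eval s) (a.eval s) := rfl

@[simp] theorem run_seq (p q : Cmd) (s : Store) : (seq p q).run s = q.run (p.run s) := rfl

open Classical in
@[simp] theorem run_ite (c : Term) (p q : Cmd) (s : Store) :
    (ite c p q).run s = if c.Holds s then p.run s else q.run s := by
  by_cases h : c.eval s = 0 <;> simp [run, Term.Holds, h]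

theorem run_each_induction {x : ℕ} {p : Cmd} {s : Store} (P : ℕ → Store → Prop) (h0 : P 0 s)
    (h : ∀ i < s.var 2, ∀ r, P i r → P (i + 1) (p.run (r.setVar x i))) :
    P (s.var 2) ((each x p).run s) :=
  forRange_induction P h0 h

end Cmd

/-! ### Reading a digraph -/

namespace ColoredDigraph

variable (x : ColoredDigraph)

theorem length_enc : x.enc.length = 1 + x.n + x.n * x.n := by
  simp [enc]
  omega

theorem enc_color (i : Fin x.n) : x.enc.getD (1 + i) 0 = x.color i := by
  rw [enc, Nat.add_comm, List.getD_cons_succ, List.getD_append _ _ _ _ (by simp)]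
  rw [List.getD_eq_getElem _ _ (by simp)]
  simp

open Classical in
theorem enc_adj {i k : ℕ} (hi : i < x.n) (hk : k < x.n) :
    x.enc.getD (1 + x.n + i * x.n + k) 0 = if natAdj x.graph i k then 1 else 0 := by
  have hlt : k + x.n * i < x.n * x.n := by nlinarith
  rw [enc, show 1 + x.n + i * x.n + k = x.n + (k + x.n * i) + 1 by ring, List.getD_cons_succ,
    List.getD_append_right _ _ _ _ (by simp)]
  rw [List.getD_eq_getElem _ _ (by simpa using hlt)]
  have e : finProdFinEquiv (⟨i, hi⟩, ⟨k, hk⟩) = (⟨k + x.n * i, hlt⟩ : Fin (x.n * x.n)) := rfl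
  have e' := finProdFinEquiv.symm_apply_apply ((⟨i, hi⟩, ⟨k, hk⟩) : Fin x.n × Fin x.n)
  rw [e] at e'
  have e1 : Fin.divNat (⟨k + x.n * i, hlt⟩ : Fin (x.n * x.n)) = ⟨i, hi⟩ := congrArg Prod.fst e'
  have e2 : Fin.modNat (⟨k + x.n * i, hlt⟩ : Fin (x.n * x.n)) = ⟨k, hk⟩ := congrArg Prod.snd e'
  simp [e1, e2, natAdj, hi, hk]

end ColoredDigraph

/-- Puts the number `n` of vertices in variable `3`, the two nonzero weights in the variables `4`
and `5`, and the position of the `i`-th row of the adjacency matrix in cell `i` of array `9`. -/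
def loadCmd : Cmd :=
  .seq (.assign 3 (.get 0 (.const 0))) <|
  -- Multiplication is not available: the square of `n + 1` is a sum of `n + 1` equal terms, `n * (n
  -- + 1)` is that square minus `n + 1`, and the row positions come from repeated addition.
  .seq (.assign 4 (.sum 20 (.ite (.lt (.var 20) (.add (.var 3) (.const 1)))
    (.add (.var 3) (.const 1)) (.const 0)))) <|
  .seq (.assign 5 (.sub (.var 4) (.add (.var 3) (.const 1)))) <|
  .seq (.put 9 (.const 0) (.add (.var 3) (.const 1))) <|
  .each 10 (.put 9 (.add (.var 10) (.const 1)) (.add (.get 9 (.var 10)) (.var 3)))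

/-- The store holds the digraph `x` as `loadCmd` leaves it. -/
structure Loaded (x : ColoredDigraph) (s : Store) : Prop where
  arr_zero : s.arr 0 = fun i => x.enc.getD i 0
  le_var_two : 1 + x.n + x.n * x.n ≤ s.var 2
  var_three : s.var 3 = x.n
  var_four : s.var 4 = (x.n + 1) * (x.n + 1)
  var_five : s.var 5 = x.n * (x.n + 1)
  arr_nine : ∀ i < x.n, s.arr 9 i = 1 + x.n + i * x.n

theorem Loaded.n_le {x : ColoredDigraph} {s : Store} (h : Loaded x s) : x.n ≤ s.var 2 := by
  have := h.le_var_two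
  nlinarith

theorem Loaded.adj {x : ColoredDigraph} {s : Store} (h : Loaded x s) {i k : ℕ} (hi : i < x.n)
    (hk : k < x.n) : s.arr 0 (s.arr 9 i + k) = 0 ↔ ¬ natAdj x.graph i k := by
  rw [h.arr_nine i hi, h.arr_zero]
  dsimp only
  rw [x.enc_adj hi hk]
  simp

/-- Frame rule for the digraph data; for concrete commands the hypothesis is `rfl`. -/
theorem Loaded.run {x : ColoredDigraph} {s : Store} (h : Loaded x s) (p : Cmd)
    (hv : (p.writesVar 2 || p.writesVar 3 || p.writesVar 4 || p.writesVar 5 ||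
      p.writesArr 0 || p.writesArr 9) = false) : Loaded x (p.run s) := by
  simp only [Bool.or_eq_false_iff] at hv
  obtain ⟨⟨⟨⟨⟨h2, h3⟩, h4⟩, h5⟩, h0⟩, h9⟩ := hv
  exact ⟨by rw [p.run_arr s h0, h.arr_zero], by rw [p.run_var s h2]; exact h.le_var_two,
    by rw [p.run_var s h3, h.var_three], by rw [p.run_var s h4, h.var_four],
    by rw [p.run_var s h5, h.var_five], by rw [p.run_arr s h9]; exact h.arr_nine⟩

theorem sum_ite_lt {m N : ℕ} (h : m ≤ N) (c : ℕ) [∀ i, Decidable (i < m)] :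
    (∑ i ∈ Finset.range N, if i < m then c else 0) = m * c := by
  rw [← Finset.sum_filter, Finset.sum_const, smul_eq_mul]
  congr 1
  convert Finset.card_range m using 2
  ext i
  simp
  omega

theorem loaded_loadCmd {x : ColoredDigraph} {s : Store} (h0 : s.arr 0 = fun i => x.enc.getD i 0)
    (h2 : 1 + x.n + x.n * x.n ≤ s.var 2) : Loaded x (loadCmd.run s) := by
  have e0 : s.arr 0 0 = x.n := by rw [h0]; rfl
  have hle : x.n + 1 ≤ s.var 2 := by nlinarith
  simp only [loadCmd, Cmd.run_seq]
  set s1 := (Cmd.put 9 (.const 0) (.add (.var 3) (.const 1))).run _ with hs1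
  have h1 : s1.arr 0 = s.arr 0 ∧ s1.var 2 = s.var 2 ∧ s1.var 3 = x.n ∧
      s1.var 4 = (x.n + 1) * (x.n + 1) ∧ s1.var 5 = x.n * (x.n + 1) ∧ s1.arr 9 0 = x.n + 1 := by
    have hsum := sum_ite_lt hle (x.n + 1)
    simp only [Order.lt_add_one_iff] at hsum
    simp [hs1, e0, hsum]
    rw [Nat.mul_comm x.n (x.n + 1), Nat.mul_succ, Nat.add_sub_cancel]
  clear_value s1
  obtain ⟨a0, v2, v3, v4, v5, a9⟩ := h1
  have key := Cmd.run_each_induction (x := 10) (s := s1)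
    (p := .put 9 (.add (.var 10) (.const 1)) (.add (.get 9 (.var 10)) (.var 3)))
    (fun m r => r.var 3 = x.n ∧ ∀ i ≤ m, r.arr 9 i = 1 + x.n + i * x.n)
    ⟨v3, by simp [a9, add_comm]⟩ (by
      rintro m - r ⟨hr3, hr9⟩
      refine ⟨by simp [hr3], fun i hi => ?_⟩
      by_cases him : i = m + 1
      · subst him
        simp [hr3, hr9 m le_rfl]
        ring
      · simp [him, hr9 i (by omega)])
  refine ⟨?_, ?_, ?_, ?_, ?_, fun i hi => key.2 i (by omega)⟩
  · rw [Cmd.run_arr _ _ rfl, a0, h0]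
  · rwa [Cmd.run_var _ _ rfl, v2]
  · rw [Cmd.run_var _ _ rfl, v3]
  · rw [Cmd.run_var _ _ rfl, v4]
  · rw [Cmd.run_var _ _ rfl, v5]

/-! ### The auction as a command -/

/-- The weight of the pair in the variables `i` and `k`. -/
def weightTerm (i k : ℕ) : Term :=
  .ite (.get 0 (.add (.get 9 (.var i)) (.var k))) (.var 4)
    (.ite (.eq (.var i) (.var k)) (.var 5) (.const 0))

/-- One bid, with the owners in array `3` and the prices in array `4`. -/
def bidCmd : Cmd :=
  .seq (.assign 12 (.least 20 21 (.and (.lt (.var 20) (.var 3)) (.all 22 (.imp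
    (.lt (.var 22) (.var 3)) (.not (.eq (.get 3 (.var 22)) (.add (.var 20) (.const 1))))))))) <|
  .ite (.lt (.var 12) (.var 3))
    (.seq (.assign 13 (.least 20 21 (.and (.lt (.var 20) (.var 3)) (.all 22 (.imp
      (.lt (.var 22) (.var 3)) (.le (.add (weightTerm 12 22) (.get 4 (.var 20)))
        (.add (weightTerm 12 20) (.get 4 (.var 22))))))))) <|
     .seq (.put 3 (.var 13) (.add (.var 12) (.const 1))) <|
     .put 4 (.var 13) (.add (.get 4 (.var 13)) (.const 1)))
    .skip

theorem forall_lt_imp_lt {n N : ℕ} (h : n ≤ N) {P : ℕ → Prop} :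
    (∀ i < N, i < n → P i) ↔ ∀ i < n, P i :=
  ⟨fun hP i hi => hP i (hi.trans_le h) hi, fun hP i _ hi => hP i hi⟩

theorem Loaded.eval_weightTerm {x : ColoredDigraph} {s : Store} (h : Loaded x s) {i k : ℕ}
    (hi : s.var i < x.n) (hk : s.var k < x.n) :
    (weightTerm i k).eval s = weight x.graph (s.var i) (s.var k) := by
  classical
  have := h.adj hi hk
  simp only [weightTerm, Term.eval_ite, Term.holds_get, Term.eval_add, Term.eval_get,
    Term.eval_var, ne_eq, this, not_not, Term.holds_eq, h.var_four, h.var_five, weight,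
    Term.eval_const]

theorem Loaded.setVar {x : ColoredDigraph} {s : Store} (h : Loaded x s) {y : ℕ} (hy : 5 < y)
    (v : ℕ) : Loaded x (s.setVar y v) := by
  constructor
  · exact h.arr_zero
  · simpa [show 2 ≠ y by omega] using h.le_var_two
  · simpa [show 3 ≠ y by omega] using h.var_three
  · simpa [show 4 ≠ y by omega] using h.var_four
  · simpa [show 5 ≠ y by omega] using h.var_five
  · exact h.arr_nine

/-- The search term `Term.least` evaluates to `leastBelow` with the loop bound as cut-off, so both
choices, including ties, agree exactly with those of `bid`. -/
theorem Loaded.run_bidCmd {x : ColoredDigraph} {s : Store} (h : Loaded x s) :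
    ((bidCmd.run s).arr 3, (bidCmd.run s).arr 4) =
      bid (s.var 2) x.n (weight x.graph) (s.arr 3, s.arr 4) := by
  rw [bidCmd, Cmd.run_seq, Cmd.run_assign, Term.eval_least _ _ (by norm_num)
    (fun i => i < x.n ∧ ∀ j < x.n, s.arr 3 j ≠ i + 1) (by norm_num)
    (by intro i k; simp [h.var_three, forall_lt_imp_lt h.n_le])]
  rw [bid]
  dsimp only
  generalize leastBelow (s.var 2) (fun i => i < x.n ∧ ∀ j < x.n, s.arr 3 j ≠ i + 1) = i
  rw [Cmd.run_ite, Term.holds_lt]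
  simp only [Term.eval_var, Store.setVar_var, if_true, Nat.reduceEqDiff,
    if_false, h.var_three]
  by_cases hi : i < x.n
  · simp only [hi, if_true]
    rw [Cmd.run_seq, Cmd.run_assign, Term.eval_least _ _ (by norm_num)
      (fun j => j < x.n ∧ ∀ k < x.n,
        weight x.graph i k + s.arr 4 j ≤ weight x.graph i j + s.arr 4 k)
      (by norm_num)]
    · simp
    · intro y j
      have hn : x.n ≤ s.var 2 := h.n_le
      rw [← forall_lt_imp_lt hn]
      simp only [Term.holds_and, Term.holds_lt, Term.holds_all, Term.holds_imp, Term.holds_le,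
        Term.eval_var, Store.setVar_var, if_true, Term.eval_add, Term.eval_get, Store.setVar_arr,
        Nat.reduceEqDiff, if_false, h.var_three]
      -- The bounds on `j` and `k` must be at hand first: `weightTerm` reads the matrix correctly
      -- only for genuine vertices.
      refine and_congr_right fun hj => forall₂_congr fun k _ => imp_congr_right fun hk => ?_
      have h' := (((h.setVar (y := 12) (by norm_num) i).setVar (y := 21) (by norm_num) y).setVar
        (y := 20) (by norm_num) j).setVar (y := 22) (by norm_num) k
      rw [h'.eval_weightTerm (by simpa using hi) (by simpa using hk),
        h'.eval_weightTerm (by simpa using hi) (by simpa using hj)]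
      simp
  · simp [hi]

/-- The auction, and then the objects won by the bidders in array `5`. -/
def auctionCmd : Cmd :=
  .seq (.each 10 (.each 11 bidCmd)) <|
  .each 10 (.put 5 (.var 10) (.least 20 21 (.and (.lt (.var 20) (.var 3))
    (.eq (.get 3 (.var 20)) (.add (.var 10) (.const 1))))))

/-- Two nested loops perform `N * N` bids; after `m` outer and `l` inner rounds the state is that
after `m * N + l` bids. -/
theorem Loaded.run_auctionCmd {x : ColoredDigraph} {s : Store} (h : Loaded x s)
    (h3 : s.arr 3 = fun _ => 0) (h4 : s.arr 4 = fun _ => 0) :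
    ∀ i < s.var 2, (auctionCmd.run s).arr 5 i = wonBy (s.var 2) x.n
      (auction (s.var 2) x.n (weight x.graph) (s.var 2 * s.var 2)).1 i := by
  set N := s.var 2 with hN
  have outer := Cmd.run_each_induction (x := 10) (s := s) (p := .each 11 bidCmd)
    (fun m r => Loaded x r ∧ r.var 2 = N ∧
      (r.arr 3, r.arr 4) = auction N x.n (weight x.graph) (m * N))
    ⟨h, rfl, by simp [h3, h4, auction]⟩ (by
      rintro m - r ⟨hr, hr2, hra⟩
      have inner := Cmd.run_each_induction (x := 11) (s := r.setVar 10 m) (p := bidCmd)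
        (fun l r => Loaded x r ∧ r.var 2 = N ∧
          (r.arr 3, r.arr 4) = auction N x.n (weight x.graph) (m * N + l))
        ⟨hr.setVar (by norm_num) m, by simp [hr2], by simpa using hra⟩ (by
          rintro l - q ⟨hq, hq2, hqa⟩
          have hq' := hq.setVar (y := 11) (by norm_num) l
          refine ⟨hq'.run _ rfl, by rw [Cmd.run_var _ _ rfl]; simp [hq2], ?_⟩
          rw [hq'.run_bidCmd]
          simp only [Store.setVar_arr, Store.setVar_var, Nat.reduceEqDiff,
            if_false, hq2, hqa]
          exact (Function.iterate_succ_apply' _ _ _).symm)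
      simpa [hr2, Nat.succ_mul] using inner)
  rw [← hN] at outer
  rw [auctionCmd, Cmd.run_seq]
  generalize (Cmd.each 10 (Cmd.each 11 bidCmd)).run s = r at outer
  obtain ⟨hr, hr2, hra⟩ := outer
  rw [← hra]
  have := Cmd.run_each_induction (x := 10) (s := r)
    (p := .put 5 (.var 10) (.least 20 21 (.and (.lt (.var 20) (.var 3))
      (.eq (.get 3 (.var 20)) (.add (.var 10) (.const 1))))))
    (fun m q => Loaded x q ∧ q.var 2 = N ∧ q.arr 3 = r.arr 3 ∧
      ∀ i < m, q.arr 5 i = wonBy N x.n (r.arr 3) i)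
    ⟨hr, hr2, rfl, by simp⟩ (by
      rintro m - q ⟨hq, hq2, hq3, hqi⟩
      have hq' := hq.setVar (y := 10) (by norm_num) m
      refine ⟨hq'.run _ rfl, by rw [Cmd.run_var _ _ rfl]; simp [hq2],
        by rw [Cmd.run_arr _ _ rfl]; exact hq3, fun i hi => ?_⟩
      rw [Cmd.run_put, Term.eval_least _ _ (by norm_num)
        (fun j => j < x.n ∧ r.arr 3 j = m + 1) (by norm_num)
        (by intro i k; simp [hq.var_three, hq3])]
      by_cases him : i = m
      · subst him
        simp [wonBy, hq2]
      · simp [him, hqi i (by omega)])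
  rw [hr2] at this
  exact this.2.2.2

/-! ### Writing the cycles of a permutation -/

theorem Store.output_eq {s : Store} {L : List ℕ} (h0 : s.var 0 = L.length)
    (h : ∀ i < L.length, s.arr 0 i = L.getD i 0) : s.output = L := by
  refine List.ext_getElem (by simp [Store.output, h0]) fun i h1 h2 => ?_
  simp [Store.output, h i h2, h2]

/-- Whether there is an arc from the vertex `a` to the vertex `b`. -/
def adjTerm (a b : Term) : Term := .get 0 (.add (.get 9 a) b)

theorem Loaded.holds_adjTerm {x : ColoredDigraph} {s : Store} (h : Loaded x s) {a b : Term}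
    (ha : a.eval s < x.n) (hb : b.eval s < x.n) :
    (adjTerm a b).Holds s ↔ natAdj x.graph (a.eval s) (b.eval s) := by
  simp [adjTerm, h.adj ha hb]

/-- One step along a cycle. -/
def walkCmd : Cmd :=
  .ite (.get 7 (.var 15)) .skip <|
  .seq (.put 7 (.var 15) (.const 1)) <|
  .seq (.assign 16 (.add (.var 16) (.const 1))) <|
  .seq (.put 6 (.add (.var 14) (.var 16)) (.var 15)) <|
  .assign 15 (.get 5 (.var 15))

/-- Writes the cycle through vertex `10` if it is new and not an isolated fixed point. -/
def emitCycleCmd : Cmd :=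
  .ite (.and (.lt (.var 10) (.var 3)) (.and (.not (.get 7 (.var 10)))
      (adjTerm (.var 10) (.get 5 (.var 10)))))
    (.seq (.assign 15 (.var 10)) <|
     .seq (.assign 16 (.const 0)) <|
     .seq (.each 11 walkCmd) <|
     .seq (.put 6 (.var 14) (.var 16)) <|
     .assign 14 (.add (.var 14) (.add (.var 16) (.const 1))))
    .skip

theorem encCycles_concat {n : ℕ} (S : List (List (Fin n))) (c : List (Fin n)) :
    encCycles (S ++ [c]) = encCycles S ++ (c.length :: c.map Fin.val) := by
  simp [encCycles]

/-- The store holds the cycles `S`: their word in array `6`, its length in variable `14`, and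
their vertices in array `7`. -/
structure Emitted {n : ℕ} (S : List (List (Fin n))) (s : Store) : Prop where
  length : s.var 14 = (encCycles S).length
  word : ∀ i < (encCycles S).length, s.arr 6 i = (encCycles S).getD i 0
  seen : ∀ u : Fin n, s.arr 7 u = 0 ↔ u ∉ S.flatten

/-- The loop makes at least `n` rounds whatever the length `k` of the orbit. The invariant therefore
speaks of `min t k`: rounds beyond the period do nothing. The cell at the old end of the word is
left open for the length, known only after the walk. -/
theorem Emitted.run_walk {n : ℕ} {S : List (List (Fin n))} {s : Store} (h : Emitted S s)
    {σ : Equiv.Perm (Fin n)} (hσ : ∀ i : Fin n, s.arr 5 i = σ i) {v : Fin n}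
    (hv : ∀ k, σ^[k] v ∉ S.flatten) (h15 : s.var 15 = v) (h16 : s.var 16 = 0)
    (hn : n ≤ s.var 2) :
    let r := (Cmd.each 11 walkCmd).run s
    let k := Function.minimalPeriod σ v
    r.var 16 = k ∧ (∀ i < s.var 14, r.arr 6 i = s.arr 6 i) ∧
      (∀ i < k, r.arr 6 (s.var 14 + 1 + i) = σ^[i] v) ∧
      ∀ u : Fin n, r.arr 7 u = 0 ↔ u ∉ S.flatten ∧ ∀ i < k, σ^[i] v ≠ u := by
  intro r k
  have hk0 : 0 < k := Function.minimalPeriod_pos_of_mem_periodicPts (σ.injective.mem_periodicPts v)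
  have hkn : k ≤ n := by
    have := (Function.nodup_periodicOrbit (f := σ) (x := v) : (orbitList σ v).Nodup).length_le_card
    simpa [orbitList] using this
  have key := Cmd.run_each_induction (x := 11) (s := s) (p := walkCmd)
    (fun t q => q.arr 5 = s.arr 5 ∧ q.var 14 = s.var 14 ∧ q.var 15 = σ^[min t k] v ∧
      q.var 16 = min t k ∧
      (∀ i < s.var 14, q.arr 6 i = s.arr 6 i) ∧
      (∀ i < min t k, q.arr 6 (s.var 14 + 1 + i) = σ^[i] v) ∧
      ∀ u : Fin n, q.arr 7 u = 0 ↔ u ∉ S.flatten ∧ ∀ i < min t k, σ^[i] v ≠ u)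
    ⟨rfl, rfl, by simp [h15], by simp [h16], fun _ _ => rfl, by simp, by simpa using h.seen⟩ (by
      rintro t - q ⟨q5, q14, q15, q16, qout, qcyc, qseen⟩
      rw [walkCmd, Cmd.run_ite, Term.holds_get]
      simp only [Term.eval_var, Store.setVar_var, Nat.reduceEqDiff, if_false, q15,
        Store.setVar_arr]
      by_cases htk : t < k
      · have e : min t k = t := min_eq_left htk.le
        have e' : min (t + 1) k = t + 1 := min_eq_left htk
        rw [e] at q15 q16 qcyc qseen
        rw [e, e']
        have h0 : q.arr 7 (σ^[t] v) = 0 := by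
          refine (qseen _).2 ⟨hv t, fun i hi he => ?_⟩
          have := Function.iterate_injOn_Iio_minimalPeriod (f := σ) (x := v)
            (Set.mem_Iio.2 (hi.trans htk)) (Set.mem_Iio.2 htk) he
          omega
        rw [if_neg (by simpa using h0)]
        refine ⟨by simp [q5], by simp [q14], ?_, by simp [q16], ?_, ?_, ?_⟩
        · simp [q15, q5, hσ, Function.iterate_succ_apply', -Function.iterate_succ]
        · intro i hi
          have : i ≠ q.var 14 + (q.var 16 + 1) := by omega
          simp [this, qout i hi]
        · intro i hi
          by_cases hit : i = t
          · subst hit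
            simp [q14, q16, q15, add_assoc, add_comm 1]
          · have : s.var 14 + 1 + i ≠ q.var 14 + (q.var 16 + 1) := by omega
            simp [this, qcyc i (by omega)]
        · intro u
          by_cases hu : u = σ^[t] v
          · subst hu
            simp only [Cmd.run_seq, Cmd.run_put, Cmd.run_assign, Store.setArr_arr,
              Store.setVar_arr, Nat.reduceEqDiff, if_false, if_true, Term.eval_var,
              Store.setVar_var, q15, Function.update_self, Term.eval_const, one_ne_zero,
              false_iff, not_and, not_forall]
            exact fun _ => ⟨t, by omega, by simp⟩
          · have hu' : (u : ℕ) ≠ σ^[t] v := fun hne => hu (Fin.ext hne)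
            simp only [Cmd.run_seq, Cmd.run_put, Cmd.run_assign, Store.setArr_arr,
              Store.setVar_arr, Nat.reduceEqDiff, if_false, if_true, Term.eval_var,
              Store.setVar_var, q15, Function.update_of_ne hu', qseen u]
            refine and_congr_right fun _ => ⟨fun hi i hit he => ?_, fun hi i hit => hi i (by omega)⟩
            by_cases hit' : i = t
            · exact hu (hit' ▸ he.symm)
            · exact hi i (by omega) he
      · have e : min t k = k := min_eq_right (by omega)
        have e' : min (t + 1) k = k := min_eq_right (by omega)
        rw [e] at q15 q16 qcyc qseen
        rw [e, e']
        -- After a full period the walk is back at `v`, which is already marked.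
        have h0 : q.arr 7 (σ^[k] v) ≠ 0 := fun h0 =>
          ((qseen _).1 h0).2 0 hk0 (Function.iterate_minimalPeriod (f := σ) (x := v)).symm
        rw [if_pos h0]
        exact ⟨q5, by simp [q14], by simp [q15], by simp [q16], qout, qcyc, qseen⟩)
  rw [min_eq_right (hkn.trans hn)] at key
  exact ⟨key.2.2.2.1, key.2.2.2.2⟩

theorem Loaded.run_emitCycle {x : ColoredDigraph} {s : Store} (hx : Loaded x s)
    {σ : Equiv.Perm (Fin x.n)} (hσ : ∀ i : Fin x.n, s.arr 5 i = σ i) {m : ℕ}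
    (h : Emitted (cyclesOf x.graph σ m) s) :
    Emitted (cyclesOf x.graph σ (m + 1)) (emitCycleCmd.run (s.setVar 10 m)) := by
  have hx' := hx.setVar (y := 10) (by norm_num) m
  have hcond : (Term.and (.lt (.var 10) (.var 3)) (.and (.not (.get 7 (.var 10)))
      (adjTerm (.var 10) (.get 5 (.var 10))))).Holds (s.setVar 10 m) ↔
      ∃ hm : m < x.n, x.graph.Adj ⟨m, hm⟩ (σ ⟨m, hm⟩) ∧
        ⟨m, hm⟩ ∉ (cyclesOf x.graph σ m).flatten := by
    rw [Term.holds_and, Term.holds_lt, ← exists_prop]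
    simp only [Term.eval_var, Store.setVar_var, if_true, Nat.reduceEqDiff, if_false, hx.var_three]
    refine exists_congr fun hm => ?_
    have hm' := hσ ⟨m, hm⟩
    have h7 := h.seen ⟨m, hm⟩
    simp only at hm' h7
    rw [Term.holds_and, hx'.holds_adjTerm (by simpa using hm) (by simp [hm'])]
    simp only [Term.holds_not, Term.holds_get, Term.eval_var, Store.setVar_var, if_true,
      Store.setVar_arr, Term.eval_get, not_not, h7, hm']
    rw [and_comm, ← natAdj_val]
  rw [emitCycleCmd, Cmd.run_ite]
  by_cases hc : ∃ hm : m < x.n, x.graph.Adj ⟨m, hm⟩ (σ ⟨m, hm⟩) ∧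
      ⟨m, hm⟩ ∉ (cyclesOf x.graph σ m).flatten
  · rw [if_pos (hcond.2 hc), cyclesOf, dif_pos hc]
    obtain ⟨hm, -, hnew⟩ := hc
    set S := cyclesOf x.graph σ m with hS
    set v : Fin x.n := ⟨m, hm⟩
    change Emitted (S ++ [orbitList σ v]) _
    -- The cycles written so far are whole orbits, so the orbit of a new vertex avoids all of them.
    have hv (k : ℕ) : σ^[k] v ∉ S.flatten := fun hk => by
      obtain ⟨c, hc, hkc⟩ := List.mem_flatten.1 hk
      refine hnew (List.mem_flatten.2 ⟨c, hc, ?_⟩)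
      obtain ⟨w, -, rfl⟩ := mem_cyclesOf hc
      rw [mem_orbitList] at hkc ⊢
      exact hkc.trans (Equiv.Perm.SameCycle.symm ⟨k, by simp [Equiv.Perm.iterate_eq_pow]⟩)
    simp only [Cmd.run_seq]
    set s1 := (Cmd.assign 16 (.const 0)).run ((Cmd.assign 15 (.var 10)).run (s.setVar 10 m))
      with hs1
    have h1 : Emitted S s1 := ⟨by simpa [hs1] using h.length, h.word, h.seen⟩
    obtain ⟨r16, rout, rcyc, rseen⟩ := h1.run_walk hσ hv (by simp [hs1, v]) (by simp [hs1])
      (by simpa [hs1] using hx.n_le)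
    have r14 := (Cmd.each 11 walkCmd).run_var (y := 14) s1 rfl
    set r := (Cmd.each 11 walkCmd).run s1
    have hl : (encCycles (S ++ [orbitList σ v])).length =
        (encCycles S).length + (Function.minimalPeriod σ v + 1) := by
      simp [encCycles_concat, orbitList]
    rw [h1.length] at r14 rout rcyc
    constructor
    · simp [hl, r14, r16]
    · intro i hi
      rw [hl] at hi
      simp only [Cmd.run_assign, Store.setVar_arr, Cmd.run_put, Store.setArr_arr, if_true,
        Term.eval_var, r14, r16, encCycles_concat]
      -- The three cases are the old word, the length of the new cycle, and its vertices.
      rcases lt_trichotomy i (encCycles S).length with hlt | rfl | hgt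
      · rw [Function.update_of_ne hlt.ne, rout i hlt, List.getD_append _ _ _ _ hlt]
        exact h.word i hlt
      · rw [Function.update_self, List.getD_append_right _ _ _ _ le_rfl]
        simp [orbitList]
      · obtain ⟨d, rfl⟩ := Nat.exists_eq_add_of_le (Nat.succ_le_of_lt hgt)
        rw [Nat.succ_eq_add_one] at hi hgt ⊢
        rw [Function.update_of_ne hgt.ne', rcyc d (by omega),
          List.getD_append_right _ _ _ _ (by omega)]
        rw [show (encCycles S).length + 1 + d - (encCycles S).length = d + 1 by omega,
          List.getD_cons_succ, List.getD_eq_getElem _ _ (by simp [orbitList]; omega)]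
        simp [orbitList]
    · intro u
      have := rseen u
      simp only [Cmd.run_assign, Store.setVar_arr, Cmd.run_put, Store.setArr_arr,
        Nat.reduceEqDiff, if_false, this]
      simp [orbitList, eq_comm]
  · rw [if_neg (hcond.not.2 hc), cyclesOf, dif_neg hc]
    exact ⟨by simpa using h.length, h.word, h.seen⟩

theorem cyclesOf_of_le {n : ℕ} (G : Digraph (Fin n)) (σ : Equiv.Perm (Fin n)) {m : ℕ}
    (hm : n ≤ m) : cyclesOf G σ m = cyclesOf G σ n := by
  induction m, hm using Nat.le_induction with
  | base => rfl
  | succ m hm ih => rw [cyclesOf, dif_neg fun h => by have := h.1; omega, ih]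

theorem length_flatten_le {n : ℕ} {S : List (List (Fin n))} {G : Digraph (Fin n)}
    (h : IsExchange G S) : S.flatten.length = (verts S).card ∧ S.flatten.length ≤ n := by
  have hn : S.flatten.Nodup := List.nodup_flatten.2 ⟨fun c hc => (h.1 c hc).2.1, h.2⟩
  exact ⟨(List.toFinset_card_of_nodup hn).symm, by simpa using hn.length_le_card⟩

/-- A nonempty cycle has at least as many vertices as length entries, namely one. The output word
thus fits into the range of a single copying loop. -/
theorem length_encCycles_le {n : ℕ} {S : List (List (Fin n))} (h : ∀ c ∈ S, c ≠ []) :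
    (encCycles S).length ≤ 2 * S.flatten.length := by
  induction S with
  | nil => simp [encCycles]
  | cons c S ih =>
    have h1 := ih fun c hc => h c (List.mem_cons_of_mem _ hc)
    have h2 := List.length_pos_iff.2 (h c List.mem_cons_self)
    simp only [encCycles] at h1
    simp only [encCycles, List.flatMap_cons, List.length_append, List.length_cons,
      List.length_map, List.flatten_cons]
    omega

/-- Writes the word of the cycles of the permutation in array `5`. -/
def emitCmd : Cmd :=
  .seq (.each 10 emitCycleCmd) <|
  .seq (.each 10 (.put 0 (.var 10) (.get 6 (.var 10)))) <|
  .assign 0 (.var 14)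

theorem Loaded.output_emitCmd {x : ColoredDigraph} {s : Store} (hx : Loaded x s)
    {σ : Equiv.Perm (Fin x.n)} (hF : Follows x.graph σ) (hσ : ∀ i : Fin x.n, s.arr 5 i = σ i)
    (h14 : s.var 14 = 0) (h7 : s.arr 7 = fun _ => 0) :
    (emitCmd.run s).output = encCycles (cyclesOf x.graph σ x.n) := by
  have key := Cmd.run_each_induction (x := 10) (s := s) (p := emitCycleCmd)
    (fun m r => Loaded x r ∧ r.arr 5 = s.arr 5 ∧ Emitted (cyclesOf x.graph σ m) r)
    ⟨hx, rfl, ⟨by simp [h14, cyclesOf, encCycles], by simp [cyclesOf, encCycles],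
      by simp [cyclesOf, h7]⟩⟩ (by
      rintro m - r ⟨hr, hr5, hem⟩
      refine ⟨(hr.setVar (by norm_num) m).run _ rfl, ?_, hr.run_emitCycle (by simpa [hr5]) hem⟩
      rw [Cmd.run_arr _ _ rfl]
      exact hr5)
  have h2 := (Cmd.each 10 emitCycleCmd).run_var (y := 2) s rfl
  rw [cyclesOf_of_le _ _ hx.n_le] at key
  rw [emitCmd, Cmd.run_seq, Cmd.run_seq]
  set r := (Cmd.each 10 emitCycleCmd).run s
  obtain ⟨hr, -, hem⟩ := key
  set S := cyclesOf x.graph σ x.n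
  have hS : IsExchange x.graph S := hF.isExchange_cyclesOf _
  have hlen : (encCycles S).length ≤ r.var 2 := by
    have h1 := length_encCycles_le fun c hc => (hS.1 c hc).1
    have h2 := (length_flatten_le hS).2
    nlinarith [hr.le_var_two]
  have copy := Cmd.run_each_induction (x := 10) (s := r) (p := .put 0 (.var 10) (.get 6 (.var 10)))
    (fun m q => q.arr 6 = r.arr 6 ∧ q.var 14 = r.var 14 ∧ ∀ i < m, q.arr 0 i = r.arr 6 i)
    ⟨rfl, rfl, by simp⟩ (by
      rintro m - q ⟨hq, hq', hqi⟩
      refine ⟨by simp [hq], by simp [hq'], fun i hi => ?_⟩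
      by_cases him : i = m
      · subst him; simp [hq]
      · simp [him, hqi i (by omega)])
  refine Store.output_eq ?_ fun i hi => ?_
  · simp [copy.2.1, hem.length]
  · simp only [Cmd.run_assign, Store.setVar_arr]
    rw [copy.2.2 i (by omega), hem.word i hi]

/-! ### Reading an exchange -/

/-- This form separates the closing arc from the others, as a left-to-right scan needs it. -/
theorem isDicycle_iff {V : Type*} [DecidableEq V] {G : Digraph V} {c : List V} :
    IsDicycle G c ↔ c ≠ [] ∧ c.Nodup ∧ c.IsChain G.Adj ∧
      ∀ p ∈ c.getLast?, ∀ q ∈ c.head?, G.Adj p q := by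
  unfold IsDicycle
  refine and_congr_right fun hc => and_congr_right fun _ => ?_
  obtain ⟨a, l, rfl⟩ := List.exists_cons_of_ne_nil hc
  rw [Cycle.chain_coe_cons, ← List.cons_append, List.isChain_append]
  simp

theorem isExchange_cons {V : Type*} [DecidableEq V] {G : Digraph V} {c : List V}
    {S : List (List V)} : IsExchange G (c :: S) ↔
      IsDicycle G c ∧ Disjoint c.toFinset (verts S) ∧ IsExchange G S := by
  have : Disjoint c.toFinset (verts S) ↔ ∀ d ∈ S, c.Disjoint d := by
    simp only [verts, Finset.disjoint_left, List.mem_toFinset, List.mem_flatten, List.Disjoint]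
    constructor
    · intro h d hd v hc hv; exact h hc ⟨d, hd, hv⟩
    · rintro h v hc ⟨d, hd, hv⟩; exact h d hd hc hv
  rw [this]
  simp only [IsExchange, List.forall_mem_cons, List.pairwise_cons]
  tauto

/-- `L` can follow a word that lists some complete cycles and then the vertices `c` of a cycle
that needs `r` more vertices, unless `r = 0`, where the vertices so far are `U` and the vertices
in the end are `F`. -/
def Continues {n : ℕ} (G : Digraph (Fin n)) (U : Finset (Fin n)) (c : List (Fin n)) :
    ℕ → List ℕ → Finset (Fin n) → Prop
  | 0, L, F => ∃ S, L = encCycles S ∧ IsExchange G S ∧ Disjoint U (verts S) ∧ F = U ∪ verts S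
  | r + 1, L, F => ∃ d S, d.length = r + 1 ∧ L = d.map Fin.val ++ encCycles S ∧
      IsDicycle G (c ++ d) ∧ Disjoint U d.toFinset ∧ IsExchange G S ∧
      Disjoint (U ∪ d.toFinset) (verts S) ∧ F = U ∪ d.toFinset ∪ verts S

section Continues

variable {n : ℕ} {G : Digraph (Fin n)} {U F : Finset (Fin n)} {c : List (Fin n)} {L : List ℕ}

theorem verts_cons {V : Type*} [DecidableEq V] (c : List V) (S : List (List V)) :
    verts (c :: S) = c.toFinset ∪ verts S := by
  simp [verts]

theorem encCycles_cons (d : List (Fin n)) (S : List (List (Fin n))) :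
    encCycles (d :: S) = d.length :: (d.map Fin.val ++ encCycles S) := by
  simp [encCycles]

/-- This lemma and the next two describe `Continues` letter by letter, so that it acts as the
acceptance condition of an automaton: end of input, start of a cycle, vertex of a cycle. -/
theorem continues_nil {r : ℕ} : Continues G U c r [] F ↔ r = 0 ∧ F = U := by
  cases r with
  | zero =>
    simp only [Continues, true_and]
    constructor
    · rintro ⟨S, hS, -, -, rfl⟩
      cases S with
      | nil => simp [verts]
      | cons d S => simp [encCycles] at hS
    · rintro rfl
      exact ⟨[], by simp [encCycles, IsExchange, verts]⟩
  | succ r =>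
    simp only [Continues, Nat.add_eq_zero_iff, one_ne_zero, and_false, false_and, iff_false]
    rintro ⟨d, S, hd, hL, -⟩
    cases d <;> simp at hd hL

theorem continues_header {a : ℕ} :
    Continues G U c 0 (a :: L) F ↔ a ≠ 0 ∧ Continues G U [] a L F := by
  simp only [Continues]
  constructor
  · rintro ⟨S, hS, hex, hd, rfl⟩
    cases S with
    | nil => simp [encCycles] at hS
    | cons d S =>
      rw [encCycles_cons, List.cons.injEq] at hS
      obtain ⟨rfl, rfl⟩ := hS
      rw [isExchange_cons] at hex
      rw [verts_cons, Finset.disjoint_union_right] at hd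
      have h0 : d.length ≠ 0 := fun h => hex.1.1 (List.length_eq_zero_iff.1 h)
      refine ⟨h0, ?_⟩
      obtain ⟨r, hr⟩ := Nat.exists_eq_succ_of_ne_zero h0
      rw [hr]
      exact ⟨d, S, hr, rfl, hex.1, hd.1, hex.2.2,
        Finset.disjoint_union_left.2 ⟨hd.2, hex.2.1⟩, by rw [verts_cons, Finset.union_assoc]⟩
  · rintro ⟨h0, h⟩
    obtain ⟨r, rfl⟩ := Nat.exists_eq_succ_of_ne_zero h0
    obtain ⟨d, S, hr, rfl, hdi, hd, hex, hd', rfl⟩ := h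
    rw [Finset.disjoint_union_left] at hd'
    refine ⟨d :: S, by rw [encCycles_cons, hr], isExchange_cons.2 ⟨hdi, hd'.2, hex⟩, ?_, ?_⟩
    · rw [verts_cons, Finset.disjoint_union_right]
      exact ⟨hd, hd'.1⟩
    · rw [verts_cons, Finset.union_assoc]

/-- A new vertex must be unused and reachable from the previous one, and if it is the last (`r = 0`)
it must also close the cycle. For a one-vertex cycle, the head of `c ++ [a]` is the vertex itself,
so the condition demands a loop. -/
theorem continues_vertex {r a : ℕ} (hn : c.Nodup) (hU : ∀ v ∈ c, v ∈ U)
    (hch : c.IsChain G.Adj) : Continues G U c (r + 1) (a :: L) F ↔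
      ∃ h : a < n, (⟨a, h⟩ : Fin n) ∉ U ∧ (∀ p ∈ c.getLast?, G.Adj p ⟨a, h⟩) ∧
        (r = 0 → ∀ q ∈ (c ++ [(⟨a, h⟩ : Fin n)]).head?, G.Adj ⟨a, h⟩ q) ∧
        Continues G (insert ⟨a, h⟩ U) (c ++ [⟨a, h⟩]) r L F := by
  constructor
  · rintro ⟨d, S, hr, hL, hdi, hd, hex, hd', rfl⟩
    cases d with
    | nil => simp at hr
    | cons v d =>
      simp only [List.map_cons, List.cons_append, List.cons.injEq] at hL
      obtain ⟨rfl, rfl⟩ := hL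
      have hr' : d.length = r := by simpa using hr
      rw [List.toFinset_cons, Finset.disjoint_insert_right] at hd
      have hins : U ∪ (v :: d).toFinset = insert v U ∪ d.toFinset := by
        ext u; simp
      have hvd : v ∉ d := by
        have := (isDicycle_iff.1 hdi).2.1
        rw [List.nodup_append] at this
        exact (List.nodup_cons.1 this.2.1).1
      have hch' := (isDicycle_iff.1 hdi).2.2
      refine ⟨v.2, hd.1, ?_, ?_, ?_⟩
      · have := (List.isChain_append.1 hch'.1).2.2
        intro p hp
        exact this p hp v (by simp)
      · intro hr0
        obtain rfl : d = [] := List.length_eq_zero_iff.1 (hr'.trans hr0)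
        intro q hq
        exact hch'.2 v (by simp) q hq
      · rw [hins] at hd' ⊢
        cases r with
        | zero =>
          obtain rfl : d = [] := List.length_eq_zero_iff.1 hr'
          exact ⟨S, by simp, hex, by simpa using hd', by simp⟩
        | succ r =>
          refine ⟨d, S, hr', rfl, by simpa using hdi, ?_, hex, hd', rfl⟩
          exact Finset.disjoint_insert_left.2 ⟨by simpa using hvd, hd.2⟩
  · rintro ⟨h, hvU, hlast, hhead, hcont⟩
    set v : Fin n := ⟨a, h⟩
    cases r with
    | zero =>
      obtain ⟨S, rfl, hex, hd, rfl⟩ := hcont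
      refine ⟨[v], S, rfl, rfl, isDicycle_iff.2 ⟨by simp, ?_, ?_, ?_⟩, by simpa using hvU, hex, ?_,
        ?_⟩
      · refine List.nodup_append.2 ⟨hn, by simp, fun u hu w hw => ?_⟩
        rintro rfl
        rw [List.mem_singleton.1 hw] at hu
        exact hvU (hU _ hu)
      · refine List.isChain_append.2 ⟨hch, by simp, fun p hp q hq => ?_⟩
        simp only [List.head?_cons, Option.mem_some_iff] at hq
        exact hq ▸ hlast p hp
      · intro p hp
        simp only [List.getLast?_append, List.getLast?_singleton, Option.some_or,
          Option.mem_some_iff] at hp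
        exact hp ▸ hhead rfl
      · rw [show U ∪ [v].toFinset = insert v U by ext u; simp]
        exact hd
      · congr 1
        ext u; simp
    | succ r =>
      obtain ⟨d, S, hr, rfl, hdi, hd, hex, hd', rfl⟩ := hcont
      have hins : U ∪ (v :: d).toFinset = insert v U ∪ d.toFinset := by
        ext u; simp
      rw [Finset.disjoint_insert_left] at hd
      refine ⟨v :: d, S, by simpa using hr, by simp [v], by simpa using hdi, ?_, hex,
        hins ▸ hd', by rw [hins]⟩
      rw [List.toFinset_cons, Finset.disjoint_insert_right]
      exact ⟨hvU, hd.2⟩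

end Continues

/-- Reads the next number of the word in array `1`. -/
def scanStepCmd : Cmd :=
  -- Variable `30` is the error flag, `31` the number of missing vertices of the current cycle, `32`
  -- tells that no vertex of it has been read, `33` and `34` are its first and its latest vertex,
  -- and `36` is the current number.
  .ite (.lt (.var 10) (.var 1))
    (.seq (.assign 36 (.get 1 (.var 10))) <|
     .ite (.var 31)
      (.ite (.and (.lt (.var 36) (.var 3)) (.and (.not (.get 8 (.var 36)))
          (.imp (.not (.var 32)) (adjTerm (.var 34) (.var 36)))))
        (.seq (.put 8 (.var 36) (.const 1)) <|
         .seq (.assign 31 (.sub (.var 31) (.const 1))) <|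
         .seq (.assign 33 (.ite (.var 32) (.var 36) (.var 33))) <|
         .seq (.assign 34 (.var 36)) <|
         .seq (.assign 32 (.const 0)) <|
         .ite (.imp (.not (.var 31)) (adjTerm (.var 36) (.var 33))) .skip (.assign 30 (.const 1)))
        (.assign 30 (.const 1)))
      (.seq (.assign 31 (.var 36)) <|
       .seq (.assign 32 (.const 1)) <|
       .ite (.var 36) .skip (.assign 30 (.const 1))))
    .skip

/-- The state of the scanner: the vertices so far are `U`, and `c` is the incomplete cycle. -/
structure Scanned {n : ℕ} (G : Digraph (Fin n)) (U : Finset (Fin n)) (c : List (Fin n))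
    (s : Store) : Prop where
  seen : ∀ u : Fin n, s.arr 8 u = 0 ↔ u ∉ U
  nodup : c.Nodup
  subset : ∀ v ∈ c, v ∈ U
  chain : c.IsChain G.Adj
  fresh : s.var 32 = 0 ↔ c ≠ []
  head : ∀ q ∈ c.head?, s.var 33 = q
  last : ∀ p ∈ c.getLast?, s.var 34 = p

/-- Errors are permanent: the flag is only ever set to one. -/
theorem scanStep_bad {s : Store} (h : s.var 30 ≠ 0) : (scanStepCmd.run s).var 30 ≠ 0 := by
  simp only [scanStepCmd, Cmd.run_ite, Cmd.run_seq, Cmd.run_assign, Cmd.run_skip, Cmd.run_put]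
  split_ifs <;> simp [h]

/-- One transition of the automaton: either the acceptable continuations are those of the new state,
or there are none and the error flag is raised. -/
theorem Loaded.scanStep {x : ColoredDigraph} {s : Store} (hx : Loaded x s)
    {U : Finset (Fin x.n)} {c : List (Fin x.n)} (h : Scanned x.graph U c s) (hs : s.var 30 = 0)
    (hlt : s.var 10 < s.var 1) (L : List ℕ) :
    let r := scanStepCmd.run s
    (r.var 30 = 0 ∧ ∃ U' c', Scanned x.graph U' c' r ∧ ∀ F,
      (Continues x.graph U c (s.var 31) (s.arr 1 (s.var 10) :: L) F ↔
        Continues x.graph U' c' (r.var 31) L F)) ∨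
    (r.var 30 ≠ 0 ∧ ∀ F, ¬ Continues x.graph U c (s.var 31) (s.arr 1 (s.var 10) :: L) F) := by
  intro r
  set a := s.arr 1 (s.var 10) with ha
  have hr : r = scanStepCmd.run s := rfl
  rw [scanStepCmd, Cmd.run_ite, if_pos (by simpa using hlt), Cmd.run_seq, Cmd.run_assign,
    Term.eval_get, Term.eval_var, ← ha, Cmd.run_ite] at hr
  by_cases h31 : s.var 31 = 0
  · rw [if_neg (by simp [h31]), Cmd.run_seq, Cmd.run_seq, Cmd.run_assign, Cmd.run_assign,
      Cmd.run_ite] at hr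
    rw [h31]
    by_cases ha0 : a = 0
    · right
      rw [if_neg (by simp [ha0]), Cmd.run_assign] at hr
      exact ⟨by simp [hr], fun F hF => (continues_header.1 hF).1 ha0⟩
    · left
      rw [if_pos (by simp [ha0]), Cmd.run_skip] at hr
      refine ⟨by simp [hr, hs], U, [], ⟨by simpa [hr] using h.seen, by simp, by simp, by simp,
        by simp [hr], by simp, by simp⟩, fun F => ?_⟩
      simp [continues_header, ha0, hr]
  · obtain ⟨m, hm⟩ := Nat.exists_eq_succ_of_ne_zero h31
    rw [if_pos (by simp [h31]), Cmd.run_ite] at hr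
    have hx1 := hx.setVar (y := 36) (by norm_num) a
    -- With `c` empty, variable `34` may hold a stale value; the test then skips the arc condition.
    have hfresh : c = [] ∨ ∃ p ∈ c.getLast?, s.var 34 = p := by
      rcases c.eq_nil_or_concat with hc | ⟨l, p, hc⟩
      · exact .inl hc
      · exact .inr ⟨p, by simp [hc], h.last p (by simp [hc])⟩
    have hcond : (Term.and (.lt (.var 36) (.var 3)) (.and (.not (.get 8 (.var 36)))
        (.imp (.not (.var 32)) (adjTerm (.var 34) (.var 36))))).Holds (s.setVar 36 a) ↔
        ∃ h : a < x.n, (⟨a, h⟩ : Fin x.n) ∉ U ∧ ∀ p ∈ c.getLast?, x.graph.Adj p ⟨a, h⟩ := by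
      rw [Term.holds_and, Term.holds_lt, ← exists_prop]
      simp only [Term.eval_var, Store.setVar_var, if_true, Nat.reduceEqDiff, if_false,
        hx.var_three]
      refine exists_congr fun han => ?_
      simp only [Term.holds_and, Term.holds_not, Term.holds_imp, Term.holds_get, Term.holds_var,
        Term.eval_var, Store.setVar_var, if_true, Nat.reduceEqDiff, if_false, Store.setVar_arr,
        not_not, h.seen ⟨a, han⟩, h.fresh]
      refine and_congr_right fun _ => ?_
      rcases hfresh with rfl | ⟨p, hp, hp'⟩
      · simp
      · have hc : c ≠ [] := by rintro rfl; simp at hp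
        have h34 : (Term.var 34).eval (s.setVar 36 a) = p := by simp [hp']
        rw [hx1.holds_adjTerm (by rw [h34]; exact p.2) (by simpa using han), h34]
        rw [Option.mem_def] at hp
        simp only [ne_eq, hc, not_false_eq_true, forall_const, Term.eval_var, Store.setVar_var,
          if_true, Option.mem_def, hp, Option.some.injEq, forall_eq']
        exact natAdj_val _ p ⟨a, han⟩
    rw [hm]
    by_cases hok : ∃ h : a < x.n, (⟨a, h⟩ : Fin x.n) ∉ U ∧ ∀ p ∈ c.getLast?, x.graph.Adj p ⟨a, h⟩
    · rw [if_pos (hcond.2 hok)] at hr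
      obtain ⟨han, hU, hlast⟩ := hok
      set v : Fin x.n := ⟨a, han⟩ with hv
      simp only [Cmd.run_seq] at hr
      set q := (Cmd.assign 32 (.const 0)).run _ with hq
      have hxq : Loaded x q := by
        rw [hq]
        exact ((((hx1.run (.put 8 _ _) rfl).run (.assign 31 _) rfl).run (.assign 33 _) rfl).run
          (.assign 34 _) rfl).run (.assign 32 _) rfl
      have hsc : Scanned x.graph (insert v U) (c ++ [v]) q := by
        refine ⟨fun u => ?_, ?_, ?_, ?_, by simp [hq], ?_, by simp [hq, hv]⟩
        · by_cases huv : u = v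
          · subst huv; simp [hq, hv]
          · have : (u : ℕ) ≠ a := fun h => huv (Fin.ext h)
            simp [hq, this, huv, h.seen]
        · refine List.nodup_append.2 ⟨h.nodup, by simp, fun u hu w hw => ?_⟩
          rintro rfl
          rw [List.mem_singleton.1 hw] at hu
          exact hU (h.subset _ hu)
        · intro u hu
          rcases List.mem_append.1 hu with hu | hu
          · exact Finset.mem_insert_of_mem (h.subset u hu)
          · simpa using Or.inl (List.mem_singleton.1 hu)
        · refine List.isChain_append.2 ⟨h.chain, by simp, fun p hp w hw => ?_⟩
          simp only [List.head?_cons, Option.mem_some_iff] at hw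
          exact hw ▸ hlast p hp
        · intro w hw
          cases c with
          | nil =>
            have h32 : s.var 32 ≠ 0 := fun h0 => h.fresh.1 h0 rfl
            simp only [List.nil_append, List.head?_cons, Option.mem_some_iff] at hw
            simp [hq, h32, ← hw, hv]
          | cons b c =>
            have h32 : s.var 32 = 0 := h.fresh.2 (by simp)
            simp [hq, h32, h.head w (by simpa using hw)]
      have q31 : q.var 31 = m := by simp [hq, hm]
      have q30 : q.var 30 = 0 := by simp [hq, hs]
      have q36 : q.var 36 = a := by simp [hq]
      clear_value q
      have hcond2 : (Term.imp (.not (.var 31)) (adjTerm (.var 36) (.var 33))).Holds q ↔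
          (m = 0 → ∀ w ∈ (c ++ [v]).head?, x.graph.Adj v w) := by
        simp only [Term.holds_imp, Term.holds_not, Term.holds_var, q31, ne_eq, not_not]
        refine imp_congr_right fun _ => ?_
        obtain ⟨w, hw⟩ : ∃ w, (c ++ [v]).head? = some w := by cases c <;> simp
        have h33 := hsc.head w hw
        rw [hxq.holds_adjTerm (by simp [q36, han]) (by simp [h33])]
        simp only [Term.eval_var, q36, h33, hw, Option.mem_def, Option.some.injEq, forall_eq']
        exact natAdj_val _ v w
      rw [Cmd.run_ite] at hr
      by_cases hok2 : m = 0 → ∀ w ∈ (c ++ [v]).head?, x.graph.Adj v w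
      · left
        rw [if_pos (hcond2.2 hok2), Cmd.run_skip] at hr
        rw [hr]
        refine ⟨q30, insert v U, c ++ [v], hsc, fun F => ?_⟩
        rw [continues_vertex h.nodup h.subset h.chain, q31]
        exact ⟨fun ⟨_, _, _, _, hF⟩ => hF, fun hF => ⟨han, hU, hlast, hok2, hF⟩⟩
      · right
        rw [if_neg (hcond2.not.2 hok2), Cmd.run_assign] at hr
        refine ⟨by simp [hr], fun F hF => hok2 ?_⟩
        rw [continues_vertex h.nodup h.subset h.chain] at hF
        obtain ⟨_, _, _, hF, _⟩ := hF
        exact hF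
    · right
      rw [if_neg (hcond.not.2 hok), Cmd.run_assign] at hr
      refine ⟨by simp [hr], fun F hF => hok ?_⟩
      rw [continues_vertex h.nodup h.subset h.chain] at hF
      obtain ⟨h1, h2, h3, _⟩ := hF
      exact ⟨h1, h2, h3⟩

/-- Reads the word in array `1`. The word is an exchange if the variables `30` and `31` are zero
in the end, and then array `8` marks its vertices. -/
def scanCmd : Cmd := .seq (.assign 32 (.const 1)) (.each 10 scanStepCmd)

/-- The invariant says that the whole word is acceptable with final vertex set `F` if and only if
the unread part continues the current state to `F`. Carrying `F` along yields the marks of array `8`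
together with the verdict. -/
theorem Loaded.run_scanCmd {x : ColoredDigraph} {s : Store} (hx : Loaded x s) {w : List ℕ}
    (hw : s.arr 1 = fun i => w.getD i 0) (hl : s.var 1 = w.length) (hN : w.length ≤ s.var 2)
    (h30 : s.var 30 = 0) (h31 : s.var 31 = 0) (h8 : s.arr 8 = fun _ => 0) :
    let r := scanCmd.run s
    (r.var 30 = 0 ∧ r.var 31 = 0 ↔ ∃ S, IsExchange x.graph S ∧ encCycles S = w) ∧
    ∀ S, IsExchange x.graph S → encCycles S = w → ∀ u : Fin x.n, r.arr 8 u = 0 ↔ u ∉ verts S := by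
  set V : Finset (Fin x.n) → Prop := Continues x.graph ∅ [] 0 w with hV
  have key := Cmd.run_each_induction (x := 10) (s := s.setVar 32 1) (p := scanStepCmd)
    (fun m r => Loaded x r ∧ r.arr 1 = s.arr 1 ∧ r.var 1 = s.var 1 ∧
      (r.var 30 = 0 ∧ (∃ U c, Scanned x.graph U c r ∧ ∀ F,
        (V F ↔ Continues x.graph U c (r.var 31) (w.drop m) F)) ∨
      (r.var 30 ≠ 0 ∧ ∀ F, ¬ V F)))
    ⟨hx.setVar (by norm_num) 1, rfl, by simp, .inl ⟨by simp [h30], ∅, [], ⟨by simp [h8], by simp,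
      by simp, by simp, by simp, by simp, by simp⟩, by simp [hV, h31]⟩⟩ (by
      rintro m - r ⟨hr, hr1, hrl, hst⟩
      have hr' := hr.setVar (y := 10) (by norm_num) m
      refine ⟨hr'.run _ rfl, ?_, ?_, ?_⟩
      · rw [Cmd.run_arr _ _ rfl]; exact hr1
      · rw [Cmd.run_var _ _ rfl]; simpa using hrl
      rcases hst with ⟨hr30, U, c, hsc, hF⟩ | ⟨hr30, hF⟩
      · have hsc' : Scanned x.graph U c (r.setVar 10 m) :=
          ⟨hsc.seen, hsc.nodup, hsc.subset, hsc.chain, by simpa using hsc.fresh,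
            by simpa using hsc.head, by simpa using hsc.last⟩
        by_cases hm : m < w.length
        · have := hr'.scanStep hsc' (by simpa using hr30) (by simpa [hrl, hl] using hm)
            (w.drop (m + 1))
          have hdrop : w.drop m = (r.setVar 10 m).arr 1 ((r.setVar 10 m).var 10) ::
              w.drop (m + 1) := by
            rw [List.drop_eq_getElem_cons hm]
            simp [hr1, hw, hm]
          rw [← hdrop] at this
          simp only [Store.setVar_var, Nat.reduceEqDiff, if_false] at this
          rcases this with ⟨h1, U', c', h2, h3⟩ | ⟨h1, h2⟩
          · exact .inl ⟨h1, U', c', h2, fun F => (hF F).trans (h3 F)⟩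
          · exact .inr ⟨h1, fun F => (hF F).not.2 (h2 F)⟩
        -- The loop bound may exceed the length of the word; the extra rounds are idle.
        · have hskip : scanStepCmd.run (r.setVar 10 m) = r.setVar 10 m := by
            rw [scanStepCmd, Cmd.run_ite, if_neg (by simpa [hrl, hl] using hm), Cmd.run_skip]
          rw [hskip]
          refine .inl ⟨by simpa using hr30, U, c, hsc', fun F => ?_⟩
          rw [hF F, List.drop_of_length_le (by omega), List.drop_of_length_le (by omega)]
          simp
      · exact .inr ⟨scanStep_bad (by simpa using hr30), hF⟩)
  have h2 : (s.setVar 32 1).var 2 = s.var 2 := by simp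
  rw [h2, List.drop_of_length_le hN] at key
  have hVS (F : Finset (Fin x.n)) : V F ↔ ∃ S, w = encCycles S ∧ IsExchange x.graph S ∧
      F = verts S := by
    simp [hV, Continues]
  intro r
  rw [← show r = (Cmd.each 10 scanStepCmd).run (s.setVar 32 1) from rfl] at key
  rcases key.2.2.2 with ⟨hr30, U, c, hsc, hF⟩ | ⟨hr30, hF⟩
  · simp only [continues_nil] at hF
    constructor
    · constructor
      · rintro ⟨-, hr31⟩
        obtain ⟨S, h1, h2, -⟩ := (hVS U).1 ((hF U).2 ⟨hr31, rfl⟩)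
        exact ⟨S, h2, h1.symm⟩
      · rintro ⟨S, h1, h2⟩
        exact ⟨hr30, ((hF (verts S)).1 ((hVS _).2 ⟨S, h2.symm, h1, rfl⟩)).1⟩
    · intro S h1 h2 u
      rw [((hF (verts S)).1 ((hVS _).2 ⟨S, h2.symm, h1, rfl⟩)).2]
      exact hsc.seen u
  · have hno : ¬ ∃ S, IsExchange x.graph S ∧ encCycles S = w := by
      rintro ⟨S, h1, h2⟩
      exact hF _ ((hVS _).2 ⟨S, h2.symm, h1, rfl⟩)
    exact ⟨⟨fun h => absurd h.1 hr30, fun h => absurd h hno⟩,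
      fun S h1 h2 => absurd ⟨S, h1, h2⟩ hno⟩

/-! ### The decision and evaluation procedures -/

/-- Outputs the word that consists of the value of a term. -/
def answerCmd (a : Term) : Cmd := .seq (.put 0 (.const 0) a) (.assign 0 (.const 1))

theorem output_answerCmd (a : Term) (s : Store) :
    ((answerCmd a).run s).output = [a.eval s] := by
  simp [answerCmd, Store.output]

/-- The number of vertices with a property. -/
def countTerm (x : ℕ) (a : Term) : Term :=
  .sum x (.ite (.and (.lt (.var x) (.var 3)) a) (.const 1) (.const 0))

theorem eval_countTerm {n x : ℕ} {a : Term} {s : Store} (hn : s.var 3 = n) (hN : n ≤ s.var 2)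
    (hx : x ≠ 3) (P : Fin n → Prop) [DecidablePred P]
    (h : ∀ i : Fin n, a.Holds (s.setVar x i) ↔ P i) :
    (countTerm x a).eval s = (Finset.univ.filter P).card := by
  classical
  simp only [countTerm, Term.eval_sum, Term.eval_ite, Term.holds_and, Term.holds_lt,
    Term.eval_var, Store.setVar_var, if_true, hx.symm, if_false, hn, Term.eval_const]
  rw [← Finset.sum_filter, Finset.sum_const, smul_eq_mul, mul_one]
  symm
  refine Finset.card_bij (fun i _ => (i : ℕ)) (fun i hi => ?_) (fun i _ j _ hij => Fin.ext hij)
    fun b hb => ?_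
  · simp only [Finset.mem_filter, Finset.mem_univ, true_and, Finset.mem_range] at hi ⊢
    exact ⟨i.2.trans_le hN, i.2, (h i).2 hi⟩
  · simp only [Finset.mem_filter, Finset.mem_range] at hb
    exact ⟨⟨b, hb.2.1⟩, by simpa using (h ⟨b, hb.2.1⟩).1 hb.2.2, rfl⟩

theorem ColoredDigraph.n_le_length_enc (x : ColoredDigraph) : x.n ≤ x.enc.length := by
  rw [x.length_enc]; nlinarith

theorem loaded_start (x : ColoredDigraph) (ws : List (List ℕ)) :
    Loaded x (loadCmd.run (startStore (x.enc :: ws))) := by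
  refine loaded_loadCmd ?_ ?_
  · funext i; simp [startStore, Store.init]
  · simp [startStore, x.length_enc]

theorem load_start_arr (ws : List (List ℕ)) (k : ℕ) (hk : loadCmd.writesArr k = false) :
    (loadCmd.run (startStore ws)).arr k = fun i => (ws.getD k []).getD i 0 := by
  rw [Cmd.run_arr _ _ hk]
  simp [startStore, Store.init]

theorem load_start_var (ws : List (List ℕ)) (k : ℕ) (hk : loadCmd.writesVar k = false)
    (h2 : k ≠ 2) : (loadCmd.run (startStore ws)).var k = (ws.getD k []).length := by
  rw [Cmd.run_var _ _ hk]
  simp [startStore, Store.init, h2]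

theorem load_start_var_two (ws : List (List ℕ)) : (loadCmd.run (startStore ws)).var 2 =
    (ws.getD 0 []).length + (ws.getD 1 []).length := by
  rw [Cmd.run_var _ _ rfl]
  simp [startStore]

/-! #### The optimal exchange -/

/-- The auction finds an optimal permutation. -/
theorem exists_auction_perm {n : ℕ} (G : Digraph (Fin n)) : ∃ σ : Equiv.Perm (Fin n),
    (∀ i : Fin n, wonBy (1 + n + n * n) n (auction (1 + n + n * n) n (weight G)
      ((1 + n + n * n) * (1 + n + n * n))).1 i = σ i) ∧ Follows G σ ∧
      ∀ τ, Follows G τ → numArcs G τ ≤ numArcs G σ :=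
  exists_perm_of_auction_weight G le_rfl

/-- The procedure that returns the cycles of the permutation found by an auction. -/
noncomputable def auctionProcedure : DigraphProcedure := fun n G =>
  cyclesOf G (exists_auction_perm G).choose n

theorem solves_auctionProcedure : SolvesMaxSizeExchange auctionProcedure := fun _ G =>
  isMaxSizeExchange_cyclesOf (exists_auction_perm G).choose_spec.2.1
    (exists_auction_perm G).choose_spec.2.2

theorem polyTimeComputable_auctionProcedure (j : ℕ) : PolyTimeComputable
    (fun x : PerColorDigraph j => [x.1.enc])
    fun x => encCycles (ignoreColors auctionProcedure x) := by
  refine polyTimeComputable_of_cmd (.seq loadCmd (.seq auctionCmd emitCmd)) 40 (by norm_num) rfl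
    fun x => ?_
  have hx := loaded_start x.1 []
  have h2 := load_start_var_two [x.1.enc]
  have h14 := load_start_var [x.1.enc] 14 rfl (by norm_num)
  have h3 := load_start_arr [x.1.enc] 3 rfl
  have h4 := load_start_arr [x.1.enc] 4 rfl
  have h7 := load_start_arr [x.1.enc] 7 rfl
  rw [Cmd.run_seq, Cmd.run_seq]
  set s := loadCmd.run (startStore [x.1.enc])
  -- With a single input word the loop bound is the length of the encoding. It is the bound used in
  -- `exists_auction_perm`, so the machine computes the very permutation chosen there.
  have h2' : s.var 2 = 1 + x.1.n + x.1.n * x.1.n := by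
    simpa [x.1.length_enc] using h2
  have ha := hx.run_auctionCmd (by simpa using h3) (by simpa using h4)
  rw [h2'] at ha
  refine (hx.run auctionCmd rfl).output_emitCmd (exists_auction_perm x.1.graph).choose_spec.2.1
    (fun i => ?_) ?_ ?_
  · rw [ha i (by have := i.2; nlinarith)]
    exact (exists_auction_perm x.1.graph).choose_spec.1 i
  · rw [Cmd.run_var _ _ rfl, h14]; simp
  · rw [Cmd.run_arr _ _ rfl, h7]; simp

/-! #### Instances -/

/-- Whether the word in array `0` encodes a digraph with at most `j` vertices of each color. -/
def instanceTerm (j : ℕ) : Term :=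
  .and (.eq (.var 0) (.add (.add (.const 1) (.var 3))
      (.sum 20 (.ite (.lt (.var 20) (.var 3)) (.var 3) (.const 0)))))
    (.and (.all 20 (.imp (.lt (.var 3) (.var 20)) (.le (.get 0 (.var 20)) (.const 1))))
      (.all 20 (.imp (.lt (.var 20) (.var 3)) (.le (countTerm 21
        (.eq (.get 0 (.add (.const 1) (.var 21))) (.get 0 (.add (.const 1) (.var 20)))))
        (.const j)))))

/-- Conversely, a word that passes these tests is decoded by reading its entries as colors and
adjacencies; the tests ensure that nothing is lost. -/
theorem exists_enc_eq_iff {j : ℕ} {w : List ℕ} :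
    (∃ x : PerColorDigraph j, x.1.enc = w) ↔
      w.length = 1 + w.getD 0 0 + w.getD 0 0 * w.getD 0 0 ∧
      (∀ i < w.length, w.getD 0 0 < i → w.getD i 0 ≤ 1) ∧
      ∀ i < w.getD 0 0, (Finset.univ.filter fun u : Fin (w.getD 0 0) =>
        w.getD (1 + u) 0 = w.getD (1 + i) 0).card ≤ j := by
  have hdm {n i : ℕ} (h1 : n < i) (h2 : i < 1 + n + n * n) :
      ∃ u < n, ∃ k < n, i = 1 + n + u * n + k := by
    obtain ⟨d, rfl⟩ := Nat.exists_eq_add_of_lt h1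
    have hn : 0 < n := Nat.pos_of_ne_zero fun h => by subst h; omega
    refine ⟨d / n, Nat.div_lt_of_lt_mul (by omega), d % n, Nat.mod_lt _ hn, ?_⟩
    have := Nat.div_add_mod' d n
    omega
  constructor
  · rintro ⟨x, rfl⟩
    refine ⟨x.1.length_enc, fun i hi hn => ?_, fun i hi => ?_⟩
    · rw [x.1.length_enc] at hi
      change x.1.n < i at hn
      obtain ⟨u, hu, k, hk, rfl⟩ := hdm hn hi
      rw [x.1.enc_adj hu hk]
      split_ifs <;> simp
    · change i < x.1.n at hi
      change (Finset.univ.filter fun u : Fin x.1.n =>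
        x.1.enc.getD (1 + u) 0 = x.1.enc.getD (1 + i) 0).card ≤ j
      refine le_trans (le_of_eq ?_) (x.2 (x.1.color ⟨i, hi⟩))
      have h (k : Fin x.1.n) : x.1.enc.getD (1 + k) 0 = x.1.color k := x.1.enc_color k
      have hi' := h ⟨i, hi⟩
      simp only at hi'
      rw [hi']
      simp only [h]
  · rintro ⟨hl, hadj, hcol⟩
    let x : ColoredDigraph := ⟨w.getD 0 0,
      ⟨fun i k => w.getD (1 + w.getD 0 0 + i * w.getD 0 0 + k) 0 = 1⟩, fun i => w.getD (1 + i) 0⟩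
    refine ⟨⟨x, fun c => ?_⟩, ?_⟩
    -- Only colors that occur need a check, so comparing with the colors of vertices is enough.
    · rcases (Finset.univ.filter fun v => x.color v = c).eq_empty_or_nonempty with h | ⟨v, hv⟩
      · simp [h]
      · rw [Finset.mem_filter] at hv
        rw [← hv.2]
        exact hcol v v.2
    · refine List.ext_getElem (x.length_enc.trans hl.symm) fun i h1 h2 => ?_
      rw [← List.getD_eq_getElem _ 0 h1, ← List.getD_eq_getElem _ 0 h2]
      rcases i.eq_zero_or_pos with rfl | hi
      · rfl
      · by_cases hin : i ≤ x.n
        · obtain ⟨c, rfl⟩ := Nat.exists_eq_add_of_le hi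
          exact x.enc_color ⟨c, by omega⟩
        · rw [x.length_enc] at h1
          have hle := hadj i h2 (not_le.1 hin)
          obtain ⟨u, hu, k, hk, rfl⟩ := hdm (not_le.1 hin) h1
          rw [x.enc_adj hu hk]
          have : natAdj x.graph u k ↔ w.getD (1 + x.n + u * x.n + k) 0 = 1 :=
            natAdj_val x.graph ⟨u, hu⟩ ⟨k, hk⟩
          split_ifs with h
          · exact (this.1 h).symm
          · have := this.not.1 h
            omega

theorem polyTimeDecidable_instances (j : ℕ) : PolyTimeDecidable (fun w : List ℕ => [w])
    (fun w => ∃ x : PerColorDigraph j, x.1.enc = w) := by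
  classical
  refine polyTimeComputable_of_cmd (.seq (.assign 3 (.get 0 (.const 0)))
    (answerCmd (.ite (instanceTerm j) (.const 1) (.const 0)))) 40 (by norm_num) rfl fun w => ?_
  rw [Cmd.run_seq, output_answerCmd, Term.eval_ite]
  simp only [Term.eval_const]
  rw [← apply_ite (fun a : ℕ => [a])]
  refine congrArg (fun a => [a]) (if_congr ?_ rfl rfl)
  set s := (Cmd.assign 3 (.get 0 (.const 0))).run (startStore [w]) with hs
  have h0 : s.arr 0 = fun i => w.getD i 0 := by
    funext i; simp [hs, startStore, Store.init]
  have v0 : s.var 0 = w.length := by simp [hs, startStore, Store.init]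
  have v2 : s.var 2 = w.length := by simp [hs, startStore]
  have v3 : s.var 3 = w.getD 0 0 := by simp [hs, startStore, Store.init]
  clear_value s
  rw [exists_enc_eq_iff]
  generalize hn : w.getD 0 0 = n at *
  rw [instanceTerm, Term.holds_and, Term.holds_eq]
  -- An arbitrary word may announce more vertices than the loop bound. The sum then need not be the
  -- square of `n`, but both equations fail because `n` alone exceeds the length.
  have key : w.length = 1 + n + (∑ i ∈ Finset.range w.length, if i < n then n else 0) ↔
      w.length = 1 + n + n * n := by
    by_cases hle : n ≤ w.length
    · rw [sum_ite_lt hle]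
    · constructor <;> intro h
      · omega
      · exfalso
        have := Nat.zero_le (n * n)
        omega
  simp only [Term.eval_var, Term.eval_add, Term.eval_const, Term.eval_sum, Term.eval_ite,
    Term.holds_lt, Store.setVar_var, if_true, Nat.reduceEqDiff, if_false, v0, v2, v3, key]
  refine and_congr_right fun hl => ?_
  have hle : n ≤ w.length := by
    have := Nat.zero_le (n * n)
    omega
  rw [Term.holds_and, Term.holds_all, Term.holds_all, v2]
  refine and_congr ?_ ?_
  · simp [v3, h0]
  · rw [← forall_lt_imp_lt hle]
    refine forall₂_congr fun i _ => ?_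
    rw [Term.holds_imp, Term.holds_lt, Term.holds_le]
    simp only [Term.eval_var, Store.setVar_var, if_true, Nat.reduceEqDiff, if_false, v3]
    refine imp_congr_right fun hi => ?_
    rw [eval_countTerm (n := n) (by simp [v3]) (by simpa [v2] using hle) (by norm_num)
      (fun u : Fin n => w.getD (1 + u) 0 = w.getD (1 + i) 0) (fun u => by simp [h0])]
    simp

/-! #### Solutions -/

/-- The command `p` between loading and scanning is `.skip` or the auction; the side condition keeps
it away from the input and the registers of the scanner. -/
theorem run_scan_start (x : ColoredDigraph) (w : List ℕ) (p : Cmd)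
    (hp : Loaded x (p.run (loadCmd.run (startStore [x.enc, w]))))
    (h : (p.writesVar 1 || p.writesVar 2 || p.writesVar 30 || p.writesVar 31 ||
      p.writesArr 1 || p.writesArr 8) = false) :
    let r := scanCmd.run (p.run (loadCmd.run (startStore [x.enc, w])))
    Loaded x r ∧ (r.var 30 = 0 ∧ r.var 31 = 0 ↔ ∃ S, IsExchange x.graph S ∧ encCycles S = w) ∧
    ∀ S, IsExchange x.graph S → encCycles S = w → ∀ u : Fin x.n, r.arr 8 u = 0 ↔ u ∉ verts S := by
  simp only [Bool.or_eq_false_iff] at h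
  obtain ⟨⟨⟨⟨⟨h1, h2⟩, h30⟩, h31⟩, ha1⟩, ha8⟩ := h
  refine ⟨hp.run _ rfl, hp.run_scanCmd ?_ ?_ ?_ ?_ ?_ ?_⟩
  · rw [Cmd.run_arr _ _ ha1, load_start_arr _ 1 rfl]; rfl
  · rw [Cmd.run_var _ _ h1, load_start_var _ 1 rfl (by norm_num)]; rfl
  · rw [Cmd.run_var _ _ h2, load_start_var_two]; simp
  · rw [Cmd.run_var _ _ h30, load_start_var _ 30 rfl (by norm_num)]; simp
  · rw [Cmd.run_var _ _ h31, load_start_var _ 31 rfl (by norm_num)]; simp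
  · rw [Cmd.run_arr _ _ ha8, load_start_arr _ 8 rfl]; simp

theorem exists_and_encCycles_eq {n : ℕ} {P : List (List (Fin n)) → Prop} {S : List (List (Fin n))}
    {w : List ℕ} (hS : encCycles S = w) : (∃ T, P T ∧ encCycles T = w) ↔ P S :=
  ⟨fun ⟨_, hT, he⟩ => encCycles_injective n (he.trans hS.symm) ▸ hT, fun h => ⟨S, h, hS⟩⟩

theorem polyTimeDecidable_exchange (j : ℕ) :
    PolyTimeDecidable (fun a : PerColorDigraph j × List ℕ => [a.1.1.enc, a.2])
      (fun a => ∃ S, IsExchange a.1.1.graph S ∧ encCycles S = a.2) := by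
  classical
  refine polyTimeComputable_of_cmd (.seq loadCmd (.seq .skip (.seq scanCmd (answerCmd
    (.ite (.add (.var 30) (.var 31)) (.const 0) (.const 1)))))) 40 (by norm_num) rfl
    fun ⟨x, w⟩ => ?_
  obtain ⟨-, hiff, -⟩ := run_scan_start x.1 w .skip (loaded_start x.1 [w]) rfl
  simp only [Cmd.run_seq, output_answerCmd, Term.eval_ite, Term.eval_const]
  simp only [← hiff]
  generalize scanCmd.run _ = r
  by_cases h30 : r.var 30 = 0 <;> by_cases h31 : r.var 31 = 0 <;> simp [Term.Holds, h30, h31]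

/-- The loop bound now includes the length of the second word, so the auction may run longer and end
in another permutation. Any optimal one will do, as the test compares only its number of arcs with
the number of scanned vertices. -/
theorem polyTimeDecidable_maxSizeExchange (j : ℕ) :
    PolyTimeDecidable (fun a : PerColorDigraph j × List ℕ => [a.1.1.enc, a.2])
      (fun a => ∃ S, IsMaxSizeExchange a.1.1.graph S ∧ encCycles S = a.2) := by
  classical
  refine polyTimeComputable_of_cmd (.seq loadCmd (.seq auctionCmd (.seq scanCmd (answerCmd
    (.ite (.add (.var 30) (.var 31)) (.const 0)
      (.ite (.le (countTerm 20 (adjTerm (.var 20) (.get 5 (.var 20))))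
        (countTerm 20 (.get 8 (.var 20)))) (.const 1) (.const 0))))))) 40 (by norm_num) rfl
    fun ⟨x, w⟩ => ?_
  have hx := loaded_start x.1 [w]
  obtain ⟨hr, hiff, hverts⟩ := run_scan_start x.1 w auctionCmd (hx.run _ rfl) rfl
  have h5 := hx.run_auctionCmd (by rw [load_start_arr _ 3 rfl]; simp)
    (by rw [load_start_arr _ 4 rfl]; simp)
  obtain ⟨σ, hσ, hF, hopt⟩ := exists_perm_of_auction_weight x.1.graph hx.le_var_two
  have hrσ : ∀ i : Fin x.1.n, (scanCmd.run (auctionCmd.run (loadCmd.run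
      (startStore [x.1.enc, w])))).arr 5 i = σ i := fun i => by
    rw [Cmd.run_arr _ _ rfl, h5 i (i.2.trans_le hx.n_le), hσ i]
  simp only [Cmd.run_seq, output_answerCmd, Term.eval_ite, Term.eval_const]
  set r := scanCmd.run _
  by_cases hS : ∃ S, IsExchange x.1.graph S ∧ encCycles S = w
  · obtain ⟨h30, h31⟩ := hiff.2 hS
    obtain ⟨S, hS, hSw⟩ := hS
    rw [if_neg (by simp [Term.Holds, h30, h31]), Term.holds_le,
      eval_countTerm hr.var_three hr.n_le (by norm_num) (fun i => x.1.graph.Adj i (σ i)),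
      eval_countTerm hr.var_three hr.n_le (by norm_num) (fun i => i ∈ verts S)]
    · have hmax : (∃ T, IsMaxSizeExchange x.1.graph T ∧ encCycles T = w) ↔
          numArcs x.1.graph σ ≤ (Finset.univ.filter fun i => i ∈ verts S).card := by
        rw [exists_and_encCycles_eq hSw, hS.isMaxSizeExchange_iff hF hopt, Finset.filter_univ_mem]
      rw [numArcs] at hmax
      by_cases h : (Finset.univ.filter fun i => x.1.graph.Adj i (σ i)).card ≤
          (Finset.univ.filter fun i => i ∈ verts S).card
      · rw [if_pos h, if_pos (hmax.2 h)]
      · rw [if_neg h, if_neg (hmax.not.2 h)]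
    · intro i
      simp [hverts S hS hSw i]
    · intro i
      rw [(hr.setVar (y := 20) (by norm_num) i).holds_adjTerm (by simp) (by simp [hrσ])]
      simp [hrσ]
  · have h3 : (Term.add (.var 30) (.var 31)).Holds r := by
      have := hiff.not.2 hS
      simp only [Term.Holds, Term.eval_add, Term.eval_var]
      omega
    rw [if_pos h3, if_neg fun ⟨S, hm, hw⟩ => hS ⟨S, hm.1, hw⟩]

/-! #### The measure -/

/-- The number of colors of the vertices marked in array `8`: those marked vertices are counted
whose color no smaller marked vertex has. -/
def colorsTerm : Term :=
  countTerm 20 (.and (.get 8 (.var 20)) (.all 21 (.imp (.lt (.var 21) (.var 20))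
    (.imp (.get 8 (.var 21)) (.not (.eq (.get 0 (.add (.const 1) (.var 21)))
      (.get 0 (.add (.const 1) (.var 20)))))))))

/-- Each value is represented by the least element of `U` that attains it. -/
theorem card_image_eq_card_filter {n : ℕ} (U : Finset (Fin n)) (f : Fin n → ℕ) :
    (U.image f).card =
      (Finset.univ.filter fun i => i ∈ U ∧ ∀ k < i, k ∈ U → f k ≠ f i).card := by
  rw [← Finset.card_image_of_injOn (f := f)]
  · congr 1
    ext a
    simp only [Finset.mem_image, Finset.mem_filter, Finset.mem_univ, true_and]
    constructor
    · rintro ⟨i, hi, rfl⟩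
      obtain ⟨m, hm, hmin⟩ := Finset.exists_min_image (U.filter fun k => f k = f i) id
        ⟨i, by simp [hi]⟩
      rw [Finset.mem_filter] at hm
      refine ⟨m, ⟨hm.1, fun k hk hkU he => ?_⟩, hm.2⟩
      exact absurd (hmin k (by simp [hkU, he, hm.2])) (not_le.2 hk)
    · rintro ⟨i, hi, rfl⟩
      exact ⟨i, hi.1, rfl⟩
  · intro i hi k hk he
    simp only [Finset.coe_filter, Finset.mem_univ, true_and, Set.mem_ofPred_eq] at hi hk
    rcases lt_trichotomy i k with h | h | h
    · exact absurd he (hk.2 i h hi.1)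
    · exact h
    · exact absurd he.symm (hi.2 k h hk.1)

/-- Stated over an arbitrary index type so that it covers the feasible pairs of both problems. The
input is known to be an exchange, so only the marks of the scan are used, not its verdict. -/
theorem polyTimeComputable_numColors {j : ℕ} {α : Type} (inst : α → PerColorDigraph j)
    (sol : (a : α) → List (List (Fin (inst a).1.n)))
    (hsol : ∀ a, IsExchange (inst a).1.graph (sol a)) :
    PolyTimeComputable (fun a => [(inst a).1.enc, encCycles (sol a)])
      (fun a => [numColors (inst a).1.color (sol a)]) := by
  refine polyTimeComputable_of_cmd (.seq loadCmd (.seq .skip (.seq scanCmd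
    (answerCmd colorsTerm)))) 40 (by norm_num) rfl fun a => ?_
  obtain ⟨hr, -, hv⟩ := run_scan_start (inst a).1 (encCycles (sol a)) .skip (loaded_start _ _) rfl
  have hv := hv _ (hsol a) rfl
  simp only [Cmd.run_seq, output_answerCmd]
  set r := scanCmd.run _
  rw [numColors, card_image_eq_card_filter, colorsTerm,
    eval_countTerm hr.var_three hr.n_le (by norm_num) (fun i => i ∈ verts (sol a) ∧
      ∀ k < i, k ∈ verts (sol a) → (inst a).1.color k ≠ (inst a).1.color i)]
  intro i
  have hcol (k : Fin (inst a).1.n) : r.arr 0 (1 + k) = (inst a).1.color k := by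
    rw [hr.arr_zero]
    exact (inst a).1.enc_color k
  simp only [Term.holds_and, Term.holds_get, Term.eval_var, Store.setVar_arr, Store.setVar_var,
    if_true, Nat.reduceEqDiff, if_false, Term.holds_all, Term.holds_imp, Term.holds_lt,
    Term.holds_not, Term.holds_eq, Term.eval_get, Term.eval_add, Term.eval_const, hcol, ne_eq,
    hv, not_not]
  refine and_congr_right fun _ => ⟨fun h k hk hkS => ?_, fun h k hk hki => ?_⟩
  · have := h k (k.2.trans_le hr.n_le) hk
    rw [hv, not_not, hcol] at this
    exact this hkS
  · have := h ⟨k, hki.trans i.2⟩ hki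
    rw [← hcol, ← not_not (a := _ ∈ verts _), ← hv] at this
    exact this

/-! #### Solutions are short -/

/-- Each vertex entry takes at most `n + 1`, and the length entry of a nonempty cycle at most two
per vertex. -/
theorem wordSize_encCycles_le {n : ℕ} (S : List (List (Fin n))) (h : ∀ c ∈ S, c ≠ []) :
    wordSize (encCycles S) ≤ S.flatten.length * (n + 3) := by
  induction S with
  | nil => simp [encCycles, wordSize]
  | cons c S ih =>
    have h1 := ih fun c hc => h c (List.mem_cons_of_mem _ hc)
    have h2 := List.length_pos_iff.2 (h c List.mem_cons_self)
    have h3 : ((c.map Fin.val).map fun a => a.size + 1).sum ≤ c.length * (n + 1) := by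
      refine (List.sum_le_card_nsmul _ (n + 1) fun b hb => ?_).trans (by simp)
      simp only [List.map_map, List.mem_map, Function.comp_apply] at hb
      obtain ⟨v, -, rfl⟩ := hb
      have : (v : ℕ).size ≤ v := Nat.size_le.2 Nat.lt_two_pow_self
      have := v.2
      omega
    have h4 : c.length.size ≤ c.length := Nat.size_le.2 Nat.lt_two_pow_self
    rw [wordSize] at h1 ⊢
    rw [encCycles_cons, List.map_cons, List.sum_cons, List.map_append, List.sum_append,
      List.flatten_cons, List.length_append]
    nlinarith

theorem short_of_isExchange : ∃ q : Polynomial ℕ,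
    ∀ (x : ColoredDigraph) (S : List (List (Fin x.n))), IsExchange x.graph S → wordSize (encCycles S) ≤ q.eval (wordSize x.enc) := by
  refine ⟨.X * (.X + 3), fun x S hS => ?_⟩
  simp only [Polynomial.eval_mul, Polynomial.eval_add, Polynomial.eval_X, Polynomial.eval_ofNat]
  have h1 := wordSize_encCycles_le S fun c hc => (hS.1 c hc).1
  have h2 := (length_flatten_le hS).2
  have h3 := x.n_le_length_enc.trans (length_le_wordSize _)
  exact h1.trans (Nat.mul_le_mul (h2.trans h3) (by omega))

theorem isNPO_jPCTEx (j : ℕ) : (jPCTEx j).IsNPO where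
  instances := polyTimeDecidable_instances j
  short := short_of_isExchange.imp fun _ hq x y hy => hq x.1 y hy
  solutions := polyTimeDecidable_exchange j
  measure := polyTimeComputable_numColors
    (α := (x : (jPCTEx j).Inst) × {y : (jPCTEx j).Sol x // (jPCTEx j).feasible x y})
    (fun a => a.1) (fun a => a.2.1) fun a => a.2.2

theorem isNPO_jPCTMaxEx (j : ℕ) : (jPCTMaxEx j).IsNPO where
  instances := polyTimeDecidable_instances j
  short := short_of_isExchange.imp fun _ hq x y hy => hq x.1 y hy.1
  solutions := polyTimeDecidable_maxSizeExchange j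
  measure := polyTimeComputable_numColors
    (α := (x : (jPCTMaxEx j).Inst) × {y : (jPCTMaxEx j).Sol x // (jPCTMaxEx j).feasible x y})
    (fun a => a.1) (fun a => a.2.1) fun a => a.2.2.1

/-! ### Membership in APX -/

theorem MaxProblem.IsApprox.mono {P : MaxProblem} {r r' : ℝ} (hr : r ≤ r')
    {A : (x : P.Inst) → P.Sol x} (h : P.IsApprox r A) : P.IsApprox r' A := fun x =>
  ⟨(h x).1, fun y hy => ((h x).2 y hy).trans
    (mul_le_mul_of_nonneg_right hr (Nat.cast_nonneg _))⟩

end TropicalExchange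

theorem mainTheorem5 (j : ℕ) :
    (∀ A : TropicalExchange.DigraphProcedure, TropicalExchange.SolvesMaxSizeExchange A →
      (TropicalExchange.jPCTEx j).IsApprox j (TropicalExchange.ignoreColors A) ∧
      (TropicalExchange.jPCTMaxEx j).IsApprox j (TropicalExchange.ignoreColors A)) ∧
    (∃ A : TropicalExchange.DigraphProcedure, TropicalExchange.SolvesMaxSizeExchange A ∧
      (TropicalExchange.jPCTEx j).PolyTime (TropicalExchange.ignoreColors A) ∧
      (TropicalExchange.jPCTMaxEx j).PolyTime (TropicalExchange.ignoreColors A)) ∧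
    (TropicalExchange.jPCTEx j).InAPX ∧ (TropicalExchange.jPCTMaxEx j).InAPX := by
  have hsol := TropicalExchange.solves_auctionProcedure
  have hpoly := TropicalExchange.polyTimeComputable_auctionProcedure j
  obtain ⟨h1, h2⟩ := TropicalExchange.isApprox_of_solves (j := j) hsol
  exact ⟨fun A hA => TropicalExchange.isApprox_of_solves hA, ⟨_, hsol, hpoly, hpoly⟩,
    -- The ratio in `InAPX` must be at least one, which `j` fails to be when `j = 0`.
    ⟨TropicalExchange.isNPO_jPCTEx j, max j 1, le_max_right _ _, _, hpoly,
      h1.mono (le_max_left _ _)⟩,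
    ⟨TropicalExchange.isNPO_jPCTMaxEx j, max j 1, le_max_right _ _, _, hpoly,
      h2.mono (le_max_left _ _)⟩⟩
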